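/- **Theorem 3.7.** Let $M$ be a smooth manifold of dimension $n$, let $0<T\le\infty$, let $g(t)$, $t\in[0,T)$, be a family of Riemannian metrics on $M$, smooth on $M\times[0,T)$, and let $f:M\times[0,T)\to\mathbb R$ be smooth. Suppose that $g$ solves the modified Ricci flow $$\frac{\partial}{\partial t}g_{ij}=-2R_{ij}+2\nabla_i\nabla_jf\qquad\text{on } M\times[0,T).$$ Let $\tau\in[0,T)$ and $\tilde M_\tau=M\times[0,T-\tau)$. In local coordinates $x^1,\dots,x^n$ on $M$ and $x^0=t$ on $[0,T-\tau)$, define the degenerate metric $\tilde g_\tau$ on $T^*\tilde M_\tau$ by $\tilde g^{ij}(x,t)=g^{ij}(x,t+\tau)$ for $1\le i,j\le n$ and $\tilde g^{ij}=0$ if $i=0$ or $j=0$, and the connection $\tilde\nabla_\tau$ by the Christoffel symbols $$\begin{aligned} \tilde\Gamma_{ij}^k&=\Gamma_{ij}^k &&(1\le i,j,k\le n), &\text{(D1)}\\ \tilde\Gamma_{ij}^0&=0 &&(0\le i,j\le n), &\text{(D2)}\\ \tilde\Gamma_{i0}^k=\tilde\Gamma_{0i}^k&=-R_i^k+\nabla_i\nabla^kf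 &&(1\le i,k\le n), &\text{(D3)}\\ \tilde\Gamma_{00}^k&=\nabla^k\Big(-\tfrac12R+\tfrac{\partial f}{\partial t}-\tfrac12|\nabla f|^2\Big) &&(1\le k\le n), &\text{(D4)} \end{aligned}$$ where the left sides are taken at $(x,t)$ and the right sides, formed with the Levi-Civita connection $\nabla$ of $g$, the Christoffel symbols $\Gamma_{ij}^k$, the Ricci tensor $R_{ij}$ and the scalar curvature $R$ of $g$, at $(x,t+\tau)$. Let $$\tilde R_{ijk}^l=\partial_i\tilde\Gamma_{jk}^l-\partial_j\tilde\Gamma_{ik}^l+\tilde\Gamma_{jk}^m\tilde\Gamma_{im}^l-\tilde\Gamma_{ik}^m\tilde\Gamma_{jm}^l,\qquad \tilde R_{jk}=\sum_{p=0}^n\tilde R_{pjk}^p .$$ Then $(\tilde g_\tau,\tilde\nabla_\tau)$ solves the modified Ricci flow for degenerate metrics: in all such coordinates, at every point of $\tilde M_\tau$ and for all $0\le i,j,k\le n$ (with summation over repeated indices from $0$ to $n$, and with $f$ evaluated at $(x,t+\tau)$), $$\frac{\partial}{\partial t}\tilde g^{ij}=2\tilde g^{ik}\tilde g^{jl}\big(\tilde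 R_{kl}-\tilde\nabla_k\tilde\nabla_lf\big),\tag{3.2}$$ $$\frac{\partial}{\partial t}\tilde\Gamma_{ij}^k=-\tilde g^{kl}\Big[\tilde\nabla_i\big(\tilde R_{jl}-\tilde\nabla_j\tilde\nabla_lf\big)+\tilde\nabla_j\big(\tilde R_{il}-\tilde\nabla_i\tilde\nabla_lf\big)-\tilde\nabla_l\big(\tilde R_{ij}-\tilde\nabla_i\tilde\nabla_jf\big)\Big].\tag{3.3}$$ Time derivatives at $t=0$ are one-sided. -/

import Mathlib

open Set
open scoped Manifold ContDiff

noncomputable section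

/-! ### Tensor calculus in one coordinate system

Everything here is relative to a point space `P`, a finite index type `ι`, the operators
`D i : (P → ℝ) → (P → ℝ)` of partial differentiation, and the symbols `Γ i j k = Γ_{ij}^k` of a
connection, so that the same formulas serve for space and for space-time. -/

section CoordinateCalculus

variable {ι P : Type*} [Fintype ι]

/-- `R_{ijk}^l = ∂_i Γ_{jk}^l - ∂_j Γ_{ik}^l + Γ_{jk}^m Γ_{im}^l - Γ_{ik}^m Γ_{jm}^l`. -/
def coordCurvature (D : ι → (P → ℝ) → P → ℝ) (Γ : ι → ι → ι → P → ℝ) (i j k l : ι) : P → ℝ :=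
  fun p => D i (Γ j k l) p - D j (Γ i k l) p
    + ∑ m, (Γ j k m p * Γ i m l p - Γ i k m p * Γ j m l p)

/-- The Ricci tensor `R_{jk} = R_{pjk}^p` (summed over `p`). -/
def coordRicci (D : ι → (P → ℝ) → P → ℝ) (Γ : ι → ι → ι → P → ℝ) (j k : ι) : P → ℝ :=
  fun p => ∑ q, coordCurvature D Γ q j k q p

/-- The Hessian `∇_i ∇_j h = ∂_i ∂_j h - Γ_{ij}^m ∂_m h` of a function. -/
def coordHessian (D : ι → (P → ℝ) → P → ℝ) (Γ : ι → ι → ι → P → ℝ) (h : P → ℝ) (i j : ι) :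
    P → ℝ :=
  fun p => D i (D j h) p - ∑ m, Γ i j m p * D m h p

/-- The covariant derivative `∇_i S_{jl} = ∂_i S_{jl} - Γ_{ij}^m S_{ml} - Γ_{il}^m S_{jm}` of a
covariant 2-tensor. -/
def coordCovDeriv (D : ι → (P → ℝ) → P → ℝ) (Γ : ι → ι → ι → P → ℝ) (S : ι → ι → P → ℝ)
    (i j l : ι) : P → ℝ :=
  fun p => D i (S j l) p - ∑ m, Γ i j m p * S m l p - ∑ m, Γ i l m p * S j m p

/-- The inverse metric `g^{ij}` of a metric with components `G i j = g_{ij}`. -/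
def coordInverse [DecidableEq ι] (G : ι → ι → P → ℝ) (i j : ι) : P → ℝ :=
  fun p => (Matrix.of fun a b => G a b p)⁻¹ i j

/-- The Christoffel symbols of the Levi-Civita connection,
`Γ_{ij}^k = ½ g^{kl} (∂_i g_{jl} + ∂_j g_{il} - ∂_l g_{ij})`. -/
def coordLeviCivita [DecidableEq ι] (D : ι → (P → ℝ) → P → ℝ) (G : ι → ι → P → ℝ)
    (i j k : ι) : P → ℝ :=
  fun p => 1 / 2 * ∑ l, coordInverse G k l p * (D i (G j l) p + D j (G i l) p - D l (G i j) p)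

/-- The scalar curvature `R = g^{ij} R_{ij}` of a metric. -/
def coordScalar [DecidableEq ι] (D : ι → (P → ℝ) → P → ℝ) (G : ι → ι → P → ℝ) : P → ℝ :=
  fun p => ∑ i, ∑ j, coordInverse G i j p * coordRicci D (coordLeviCivita D G) i j p

/-- The gradient `∇^k h = g^{kl} ∂_l h`. -/
def coordGrad [DecidableEq ι] (D : ι → (P → ℝ) → P → ℝ) (G : ι → ι → P → ℝ) (h : P → ℝ)
    (k : ι) : P → ℝ :=
  fun p => ∑ l, coordInverse G k l p * D l h p

/-- `|∇h|² = g^{kl} ∂_k h ∂_l h`. -/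
def coordGradNormSq [DecidableEq ι] (D : ι → (P → ℝ) → P → ℝ) (G : ι → ι → P → ℝ)
    (h : P → ℝ) : P → ℝ :=
  fun p => ∑ k, ∑ l, coordInverse G k l p * D k h p * D l h p

/-- Raising the second index of a covariant 2-tensor: `S_i^k = g^{kl} S_{il}`. -/
def coordRaise [DecidableEq ι] (G : ι → ι → P → ℝ) (S : ι → ι → P → ℝ) (i k : ι) : P → ℝ :=
  fun p => ∑ l, coordInverse G k l p * S i l p

end CoordinateCalculus

/-! ### Space and space-time coordinates -/

/-- Partial derivatives with respect to the space coordinates `x^1, …, x^n`. -/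
def spaceDeriv {n : ℕ} (i : Fin n) (F : EuclideanSpace ℝ (Fin n) → ℝ) :
    EuclideanSpace ℝ (Fin n) → ℝ :=
  fun u => fderiv ℝ F u (EuclideanSpace.single i 1)

/-- Partial derivatives on space-time with coordinates `x^0 = t ∈ J` and `x^1, …, x^n`. The time
derivative is taken within the time interval `J` (one-sided at its initial time). -/
def spacetimeDeriv {n : ℕ} (J : Set ℝ) (a : Fin (n + 1))
    (F : ℝ × EuclideanSpace ℝ (Fin n) → ℝ) : ℝ × EuclideanSpace ℝ (Fin n) → ℝ :=
  fun p => Fin.cases (derivWithin (fun s => F (s, p.2)) J p.1)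
    (fun i => spaceDeriv i (fun v => F (p.1, v)) p.2) a

/-- The interval `[0, T - τ)`; here `T = ∞` is allowed. -/
def timeInterval (T : EReal) (τ : ℝ) : Set ℝ :=
  {t | 0 ≤ t ∧ ((t + τ : ℝ) : EReal) < T}

/-! ### The modified Ricci flow on a manifold -/

section Manifold

variable {n : ℕ} {M : Type*} [TopologicalSpace M] [ChartedSpace (EuclideanSpace ℝ (Fin n)) M]
  [IsManifold 𝓘(ℝ, EuclideanSpace ℝ (Fin n)) ∞ M]

/-- A family of smooth Riemannian metrics on `M`, indexed by time. -/
abbrev MetricFamily (n : ℕ) (M : Type*) [TopologicalSpace M]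
    [ChartedSpace (EuclideanSpace ℝ (Fin n)) M]
    [IsManifold 𝓘(ℝ, EuclideanSpace ℝ (Fin n)) ∞ M] :=
  ℝ → Bundle.ContMDiffRiemannianMetric 𝓘(ℝ, EuclideanSpace ℝ (Fin n)) ∞
    (EuclideanSpace ℝ (Fin n))
    (TangentSpace 𝓘(ℝ, EuclideanSpace ℝ (Fin n)) : M → Type _)

/-- The smooth coordinate systems of `M`. -/
abbrev smoothCharts (n : ℕ) (M : Type*) [TopologicalSpace M]
    [ChartedSpace (EuclideanSpace ℝ (Fin n)) M] :
    Set (OpenPartialHomeomorph M (EuclideanSpace ℝ (Fin n))) :=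
  IsManifold.maximalAtlas 𝓘(ℝ, EuclideanSpace ℝ (Fin n)) ∞ M

/-- The coordinate vector field `∂/∂x^i` of the chart `φ`, at the point with coordinates `u`. -/
def coordVector (φ : OpenPartialHomeomorph M (EuclideanSpace ℝ (Fin n))) (i : Fin n)
    (u : EuclideanSpace ℝ (Fin n)) :
    TangentSpace 𝓘(ℝ, EuclideanSpace ℝ (Fin n)) (φ.symm u) :=
  mfderiv 𝓘(ℝ, EuclideanSpace ℝ (Fin n)) 𝓘(ℝ, EuclideanSpace ℝ (Fin n)) φ.symm u
    (EuclideanSpace.single i (1 : ℝ) : EuclideanSpace ℝ (Fin n))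

/-- The components `g_{ij}(x, t) = g(t)(∂/∂x^i, ∂/∂x^j)` in the chart `φ`. -/
def metricCoord (g : MetricFamily n M) (φ : OpenPartialHomeomorph M (EuclideanSpace ℝ (Fin n)))
    (t : ℝ) (i j : Fin n) : EuclideanSpace ℝ (Fin n) → ℝ :=
  fun u => (g t).inner (φ.symm u) (coordVector φ i u) (coordVector φ j u)

/-- A time-dependent function in the chart `φ`. -/
def funCoord (f : ℝ → M → ℝ) (φ : OpenPartialHomeomorph M (EuclideanSpace ℝ (Fin n)))
    (t : ℝ) : EuclideanSpace ℝ (Fin n) → ℝ :=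
  fun u => f t (φ.symm u)

/-- The family `g(t)`, `t ∈ J`, is smooth on space-time `M × J`: in every chart of `M` the
components `g_{ij}(x, t)` are jointly smooth. -/
def IsSmoothFamily (J : Set ℝ) (g : MetricFamily n M) : Prop :=
  ∀ φ ∈ smoothCharts n M, ∀ i j : Fin n,
    ContDiffOn ℝ ∞ (fun p : ℝ × EuclideanSpace ℝ (Fin n) => metricCoord g φ p.1 i j p.2)
      (J ×ˢ φ.target)

/-- The modified Ricci flow `∂_t g_{ij} = -2 R_{ij} + 2 ∇_i ∇_j f` on `M × J`. -/
def IsModifiedRicciFlow (J : Set ℝ) (g : MetricFamily n M) (f : ℝ → M → ℝ) : Prop :=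
  ∀ φ ∈ smoothCharts n M, ∀ t ∈ J, ∀ u ∈ φ.target, ∀ i j : Fin n,
    HasDerivWithinAt (fun s => metricCoord g φ s i j u)
      (-2 * coordRicci spaceDeriv (coordLeviCivita spaceDeriv (metricCoord g φ t)) i j u
        + 2 * coordHessian spaceDeriv (coordLeviCivita spaceDeriv (metricCoord g φ t))
            (funCoord f φ t) i j u) J t

/-! ### The degenerate metric and its connection on space-time -/

/-- The components `g̃^{ij}` of the degenerate metric `g̃_τ(x, t) = g⁻¹(x, t + τ)` on the cotangent
bundle of `M × [0, T - τ)`; the index `0` is the time index. -/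
def degMetric (g : MetricFamily n M) (τ : ℝ)
    (φ : OpenPartialHomeomorph M (EuclideanSpace ℝ (Fin n))) (a b : Fin (n + 1)) :
    ℝ × EuclideanSpace ℝ (Fin n) → ℝ :=
  fun p => Fin.cases 0 (fun i => Fin.cases 0
    (fun j => coordInverse (metricCoord g φ (p.1 + τ)) i j p.2) b) a

/-- `-R_i^k + ∇_i ∇^k f` at time `t`. -/
def mixedSymbol (g : MetricFamily n M) (f : ℝ → M → ℝ)
    (φ : OpenPartialHomeomorph M (EuclideanSpace ℝ (Fin n))) (t : ℝ) (i k : Fin n) :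
    EuclideanSpace ℝ (Fin n) → ℝ :=
  fun u =>
    - coordRaise (metricCoord g φ t)
        (coordRicci spaceDeriv (coordLeviCivita spaceDeriv (metricCoord g φ t))) i k u
    + coordRaise (metricCoord g φ t)
        (coordHessian spaceDeriv (coordLeviCivita spaceDeriv (metricCoord g φ t))
          (funCoord f φ t)) i k u

/-- `-½ R + ∂f/∂t - ½ |∇f|²` at time `t ∈ I`, where `I` is the interval of existence. -/
def timePotential (I : Set ℝ) (g : MetricFamily n M) (f : ℝ → M → ℝ)
    (φ : OpenPartialHomeomorph M (EuclideanSpace ℝ (Fin n))) (t : ℝ) :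
    EuclideanSpace ℝ (Fin n) → ℝ :=
  fun u => -(1 / 2) * coordScalar spaceDeriv (metricCoord g φ t) u
    + derivWithin (fun s => funCoord f φ s u) I t
    - 1 / 2 * coordGradNormSq spaceDeriv (metricCoord g φ t) (funCoord f φ t) u

/-- The Christoffel symbols `Γ̃_{ab}^c` of the connection `∇̃_τ` in the coordinates
`x^0 = t, x^1, …, x^n` given by a chart `φ` of `M`. For space indices `i, j, k`:
`Γ̃_{ij}^k = Γ_{ij}^k`, `Γ̃_{ab}^0 = 0` for all `a, b`,
`Γ̃_{i0}^k = Γ̃_{0i}^k = -R_i^k + ∇_i ∇^k f`, and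
`Γ̃_{00}^k = ∇^k (-½ R + ∂f/∂t - ½ |∇f|²)`, the left sides at `(x, t)` and the right sides
at `(x, t + τ)`. -/
def degConnection (I : Set ℝ) (g : MetricFamily n M) (f : ℝ → M → ℝ) (τ : ℝ)
    (φ : OpenPartialHomeomorph M (EuclideanSpace ℝ (Fin n))) (a b c : Fin (n + 1)) :
    ℝ × EuclideanSpace ℝ (Fin n) → ℝ :=
  fun p => Fin.cases 0
    (fun k => Fin.cases
      (Fin.cases
        (coordGrad spaceDeriv (metricCoord g φ (p.1 + τ)) (timePotential I g f φ (p.1 + τ)) k p.2)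
        (fun j => mixedSymbol g f φ (p.1 + τ) j k p.2) b)
      (fun i => Fin.cases
        (mixedSymbol g f φ (p.1 + τ) i k p.2)
        (fun j => coordLeviCivita spaceDeriv (metricCoord g φ (p.1 + τ)) i j k p.2) b) a) c

end Manifold

/-- The tensor `R̃_{ab} - ∇̃_a ∇̃_b f` of a connection `Γ` on space-time coordinates. -/
def modifiedRicci {n : ℕ} (J : Set ℝ)
    (Γ : Fin (n + 1) → Fin (n + 1) → Fin (n + 1) → ℝ × EuclideanSpace ℝ (Fin n) → ℝ)
    (f : ℝ × EuclideanSpace ℝ (Fin n) → ℝ) (a b : Fin (n + 1)) :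
    ℝ × EuclideanSpace ℝ (Fin n) → ℝ :=
  fun p => coordRicci (spacetimeDeriv J) Γ a b p - coordHessian (spacetimeDeriv J) Γ f a b p

/-- The pair of a degenerate metric `h^{ab}` and a connection `Γ_{ab}^c`, in space-time coordinates
with `t ∈ J` and `x ∈ U`, solves the modified Ricci flow for degenerate metrics:
`∂_t h^{ij} = 2 h^{ik} h^{jl} (R̃_{kl} - ∇̃_k ∇̃_l f)` and
`∂_t Γ_{ij}^k = - h^{kl} (∇̃_i (R̃_{jl} - ∇̃_j ∇̃_l f) + ∇̃_j (R̃_{il} - ∇̃_i ∇̃_l f)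
  - ∇̃_l (R̃_{ij} - ∇̃_i ∇̃_j f))`, all indices running over `0, …, n`. -/
def IsDegenerateModifiedRicciFlow {n : ℕ} (J : Set ℝ) (U : Set (EuclideanSpace ℝ (Fin n)))
    (h : Fin (n + 1) → Fin (n + 1) → ℝ × EuclideanSpace ℝ (Fin n) → ℝ)
    (Γ : Fin (n + 1) → Fin (n + 1) → Fin (n + 1) → ℝ × EuclideanSpace ℝ (Fin n) → ℝ)
    (f : ℝ × EuclideanSpace ℝ (Fin n) → ℝ) : Prop :=
  ∀ t ∈ J, ∀ u ∈ U,
    (∀ i j : Fin (n + 1),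
      HasDerivWithinAt (fun s => h i j (s, u))
        (2 * ∑ k, ∑ l, h i k (t, u) * h j l (t, u) * modifiedRicci J Γ f k l (t, u)) J t) ∧
    (∀ i j k : Fin (n + 1),
      HasDerivWithinAt (fun s => Γ i j k (s, u))
        (-∑ l, h k l (t, u) *
          (coordCovDeriv (spacetimeDeriv J) Γ (modifiedRicci J Γ f) i j l (t, u)
            + coordCovDeriv (spacetimeDeriv J) Γ (modifiedRicci J Γ f) j i l (t, u)
            - coordCovDeriv (spacetimeDeriv J) Γ (modifiedRicci J Γ f) l i j (t, u))) J t)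

end

/-! ### Connections over a commutative algebra with commuting derivations -/

section AlgebraicCalculus

open Matrix

/-! Let h be the inverse metric padded by a zero time row and column, and S = Ric - ∇∇f for the
space-time connection Γ. Its spatial block is the modified Ricci tensor of g(t), so the flow reads
∂_t g = -2S there, and the mixed symbols are Γ_{0i}^k = -h^{kl} S_{il} = ½ g^{kl} ∂_t g_{il}. This
is the choice that makes h parallel in the time direction too (`IsFlowConnection.parallel`). For a
torsion-free connection with a parallel symmetric bivector, the contracted Bianchi identity and the
formula for the divergence of a Hessian hold even if the bivector is degenerate. The curvature is
moreover trace free (`algCurvature_trace`), so S is symmetric.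

The main point is the time row of S. From Γ_{0m}^p = -h^{pl} S_{ml} for spatial m, `algRicci_time`
obtains Ric_{0c} = ∂_c tr(hS) - h^{ad} ∇_a S_{cd}, which equals ½ ∂_c R + Ric_{cb} ∇^b f.
Subtracting the Hessian cancels the Ricci term and leaves S_{0c} = -∂_c P with P = -½ R + ∂_t f - ½
|∇f|² (`algModifiedRicci_time`). Hence the prescribed Γ_{00}^k = ∇^k P is again -h^{kl} S_{0l}, and
Γ_{0a}^k = -h^{kl} S_{al} holds for every a; a second application of the same lemma gives S_{00} =
-∂_t P.

The evolution equations follow. The one for the metric is the derivative of an inverse matrix. For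
the connection, if a lower index is 0, the exactness of S_{0c} gives ∇_a S_{0l} = ∇_l S_{0a}, so the
bracket reduces to ∇_0 S_{al}; since h is parallel, this is the time derivative of Γ_{0a}^k =
-h^{kl} S_{al} (`algConnection_time_evolution`). If both lower indices are spatial, it is the
classical variation of the Levi-Civita connection (`space_conn_evolution`).

All identities are proved over a commutative ℝ-algebra with commuting derivations, with connections
as matrices. They are then applied to the algebra of smooth functions on J × U, and evaluation at
points recovers the coordinate statement. -/

theorem two_mul_cancel_of_algebra {𝒜 : Type*} [CommRing 𝒜] [Algebra ℝ 𝒜] {x y : 𝒜}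
    (h : 2 * x = 2 * y) : x = y := by
  have h2 : algebraMap ℝ 𝒜 (1 / 2) * 2 = 1 := by
    rw [← map_ofNat (algebraMap ℝ 𝒜) 2, ← map_mul]; norm_num
  calc x = (algebraMap ℝ 𝒜 (1 / 2) * 2) * x := by rw [h2, one_mul]
    _ = algebraMap ℝ 𝒜 (1 / 2) * (2 * y) := by rw [mul_assoc, h]
    _ = y := by rw [← mul_assoc, h2, one_mul]

variable {ι 𝒜 : Type*} [CommRing 𝒜] [Algebra ℝ 𝒜]

theorem derivation_map_add (d : Derivation ℝ 𝒜 𝒜) (A B : Matrix ι ι 𝒜) :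
    (A + B).map d = A.map d + B.map d := by
  ext i j; simp

theorem derivation_map_sub (d : Derivation ℝ 𝒜 𝒜) (A B : Matrix ι ι 𝒜) :
    (A - B).map d = A.map d - B.map d := by
  ext i j; simp

theorem derivation_map_neg (d : Derivation ℝ 𝒜 𝒜) (A : Matrix ι ι 𝒜) :
    (-A).map d = -A.map d := by
  ext i j; simp

theorem derivation_map_comm {d e : Derivation ℝ 𝒜 𝒜} (h : ∀ x, d (e x) = e (d x))
    (A : Matrix ι ι 𝒜) : (A.map e).map d = (A.map d).map e := by
  ext i j; simp [h]

variable [Fintype ι]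

theorem derivation_map_mul (d : Derivation ℝ 𝒜 𝒜) (A B : Matrix ι ι 𝒜) :
    (A * B).map d = A.map d * B + A * B.map d := by
  ext i j
  simp only [Matrix.map_apply, Matrix.mul_apply, Matrix.add_apply, map_sum, Derivation.leibniz,
    smul_eq_mul, ← Finset.sum_add_distrib]
  exact Finset.sum_congr rfl fun k _ => by ring

theorem derivation_trace (d : Derivation ℝ 𝒜 𝒜) (A : Matrix ι ι 𝒜) :
    d A.trace = (A.map d).trace := by
  simp [Matrix.trace, map_sum]

variable (D : ι → Derivation ℝ 𝒜 𝒜) (Γ : ι → Matrix ι ι 𝒜)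

/-- The curvature matrices `(R_{ab})_k^l = R_{abk}^l` of the connection matrices
`(Γ_a)_k^l = Γ_{ak}^l`. -/
def algCurvature (a b : ι) : Matrix ι ι 𝒜 :=
  (Γ b).map (D a) - (Γ a).map (D b) + (Γ b * Γ a - Γ a * Γ b)

/-- The Ricci tensor `R_{jk} = R_{pjk}^p`. -/
def algRicci : Matrix ι ι 𝒜 :=
  fun j k => ∑ p, algCurvature D Γ p j k p

/-- The Hessian of a function. -/
def algHessian (f : 𝒜) : Matrix ι ι 𝒜 :=
  fun i j => D i (D j f) - ∑ m, Γ i j m * D m f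

/-- The covariant derivative `∇_a` of a covariant 2-tensor. -/
def algCovDeriv (S : Matrix ι ι 𝒜) (a : ι) : Matrix ι ι 𝒜 :=
  S.map (D a) - Γ a * S - S * (Γ a)ᵀ

/-- The covariant derivative `∇_a R_{bcd}^e` of the curvature. -/
def algCurvatureDeriv (a b c : ι) : Matrix ι ι 𝒜 :=
  (algCurvature D Γ b c).map (D a) + algCurvature D Γ b c * Γ a - Γ a * algCurvature D Γ b c
    - ∑ m, Γ a b m • algCurvature D Γ m c - ∑ m, Γ a c m • algCurvature D Γ b m

variable {D Γ}

theorem algCurvature_swap (a b : ι) : algCurvature D Γ a b = -algCurvature D Γ b a := by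
  unfold algCurvature; abel

theorem algCovDeriv_sub (S T : Matrix ι ι 𝒜) (a : ι) :
    algCovDeriv D Γ (S - T) a = algCovDeriv D Γ S a - algCovDeriv D Γ T a := by
  unfold algCovDeriv
  rw [derivation_map_sub]; noncomm_ring

/-- With vanishing torsion the derivative terms cancel in pairs, and so do the quadratic ones; no
metric enters. -/
theorem algCurvature_bianchi_first (hΓ : ∀ a b c, Γ a b c = Γ b a c) (a b c d : ι) :
    algCurvature D Γ a b c d + algCurvature D Γ b c a d + algCurvature D Γ c a b d = 0 := by
  simp only [algCurvature, Matrix.add_apply, Matrix.sub_apply, Matrix.map_apply, Matrix.mul_apply]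
  rw [hΓ c b d, hΓ c a d, hΓ b a d]
  have h1 : ∀ m, Γ c b m = Γ b c m := fun m => hΓ c b m
  have h2 : ∀ m, Γ c a m = Γ a c m := fun m => hΓ c a m
  have h3 : ∀ m, Γ b a m = Γ a b m := fun m => hΓ b a m
  simp only [h1, h2, h3]
  ring

/-- This is the Jacobi identity for the covariant derivatives on the two matrix indices only. The
Christoffel terms for the indices a, b, c are absent, so no symmetry of Γ is needed. -/
theorem algCurvature_bianchi_second (hD : ∀ a b x, D a (D b x) = D b (D a x)) (a b c : ι) :
    ((algCurvature D Γ b c).map (D a) + algCurvature D Γ b c * Γ a - Γ a * algCurvature D Γ b c)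
    + ((algCurvature D Γ c a).map (D b) + algCurvature D Γ c a * Γ b - Γ b * algCurvature D Γ c a)
    + ((algCurvature D Γ a b).map (D c) + algCurvature D Γ a b * Γ c - Γ c * algCurvature D Γ a b)
    = 0 := by
  simp only [algCurvature, derivation_map_add, derivation_map_sub, derivation_map_mul]
  rw [derivation_map_comm (hD b a), derivation_map_comm (hD c a), derivation_map_comm (hD c b)]
  noncomm_ring

/-- The Christoffel terms acting on the form indices cancel in the cyclic sum, because Γ is
symmetric and the curvature antisymmetric in those indices. -/
theorem algCurvatureDeriv_cyclic (hD : ∀ a b x, D a (D b x) = D b (D a x))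
    (hΓ : ∀ a b c, Γ a b c = Γ b a c) (a b c : ι) :
    algCurvatureDeriv D Γ a b c + algCurvatureDeriv D Γ b c a + algCurvatureDeriv D Γ c a b
      = 0 := by
  have key := algCurvature_bianchi_second (Γ := Γ) hD a b c
  have hs : ∀ a b c : ι, ∑ m, Γ a b m • algCurvature D Γ m c
      = -∑ m, Γ b a m • algCurvature D Γ c m := fun a b c => by
    rw [← Finset.sum_neg_distrib]
    exact Finset.sum_congr rfl fun m _ => by rw [algCurvature_swap, smul_neg, hΓ a b m]
  unfold algCurvatureDeriv
  rw [hs a b c, hs b c a, hs c a b]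
  rw [← key]
  abel

/-- Covariant differentiation commutes with contraction: the Christoffel term of the upper index
cancels that of the lower index it is contracted with. -/
theorem algCurvatureDeriv_trace (a c d : ι) :
    ∑ b, algCurvatureDeriv D Γ a b c d b = algCovDeriv D Γ (algRicci D Γ) a c d := by
  simp only [algCurvatureDeriv, algCovDeriv, algRicci, Matrix.sub_apply, Matrix.add_apply,
    Matrix.map_apply, Matrix.mul_apply, Matrix.sum_apply, Matrix.smul_apply, smul_eq_mul,
    Matrix.transpose_apply, map_sum, Finset.sum_add_distrib, Finset.sum_sub_distrib]
  have h1 : ∑ b, ∑ m, algCurvature D Γ b c d m * Γ a m b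
      = ∑ b, ∑ m, Γ a b m * algCurvature D Γ m c d b := by
    rw [Finset.sum_comm]
    exact Finset.sum_congr rfl fun _ _ => Finset.sum_congr rfl fun _ _ => mul_comm _ _
  have h2 : ∑ b, ∑ m, Γ a d m * algCurvature D Γ b c m b
      = ∑ m, (∑ b, algCurvature D Γ b c m b) * Γ a d m := by
    rw [Finset.sum_comm]
    exact Finset.sum_congr rfl fun _ _ => by rw [Finset.sum_mul]; simp only [mul_comm]
  have h3 : ∑ b, ∑ m, Γ a c m * algCurvature D Γ b m d b
      = ∑ m, Γ a c m * ∑ b, algCurvature D Γ b m d b := by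
    rw [Finset.sum_comm]
    exact Finset.sum_congr rfl fun _ _ => by rw [Finset.mul_sum]
  rw [h1, h2, h3]
  ring

/-- The Ricci identity for the Hessian of a function. -/
theorem algHessian_commute (hD : ∀ a b x, D a (D b x) = D b (D a x))
    (hΓ : ∀ a b c, Γ a b c = Γ b a c) (f : 𝒜) (a b c : ι) :
    algCovDeriv D Γ (algHessian D Γ f) a c b - algCovDeriv D Γ (algHessian D Γ f) c a b
      = -∑ m, algCurvature D Γ a c b m * D m f := by
  have e1 : ∀ a c : ι, algCovDeriv D Γ (algHessian D Γ f) a c b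
      = D a (D c (D b f)) - ∑ m, D a (Γ c b m) * D m f - ∑ m, Γ c b m * D a (D m f)
        - ∑ m, Γ a c m * algHessian D Γ f m b - ∑ m, Γ a b m * D c (D m f)
        + ∑ m, (∑ k, Γ a b k * Γ c k m) * D m f := fun a c => by
    simp only [algCovDeriv, Matrix.sub_apply, Matrix.map_apply, Matrix.mul_apply,
      Matrix.transpose_apply]
    have : ∑ j, algHessian D Γ f c j * Γ a b j
        = ∑ m, Γ a b m * D c (D m f) - ∑ m, (∑ k, Γ a b k * Γ c k m) * D m f := by
      simp only [algHessian, sub_mul, Finset.sum_sub_distrib, Finset.sum_mul]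
      congr 1
      · exact Finset.sum_congr rfl fun _ _ => mul_comm _ _
      · rw [Finset.sum_comm]
        exact Finset.sum_congr rfl fun _ _ => Finset.sum_congr rfl fun _ _ => by ring
    rw [this]
    have : D a (algHessian D Γ f c b) = D a (D c (D b f)) - ∑ m, D a (Γ c b m) * D m f
        - ∑ m, Γ c b m * D a (D m f) := by
      simp only [algHessian, map_sub, map_sum, Derivation.leibniz, smul_eq_mul,
        Finset.sum_add_distrib]
      simp only [mul_comm (D _ f)]
      ring
    rw [this]; ring
  rw [e1 a c, e1 c a, hD a c]
  have : ∑ m, algCurvature D Γ a c b m * D m f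
      = ∑ m, D a (Γ c b m) * D m f - ∑ m, D c (Γ a b m) * D m f
        + (∑ m, (∑ k, Γ c b k * Γ a k m) * D m f - ∑ m, (∑ k, Γ a b k * Γ c k m) * D m f) := by
    simp only [algCurvature, Matrix.add_apply, Matrix.sub_apply, Matrix.map_apply,
      Matrix.mul_apply, add_mul, sub_mul, Finset.sum_add_distrib, Finset.sum_sub_distrib]
  rw [this]
  simp only [hΓ c a]
  ring

/-! #### Parallel symmetric bivectors -/

variable {h : Matrix ι ι 𝒜}

/-- Apply D a D b = D b D a to h and expand twice by parallelism: the difference of the two sides is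
the curvature acting on h, which must vanish. Invertibility of h plays no role, so the degenerate
case is covered. -/
theorem mul_algCurvature_antisymm (hD : ∀ a b x, D a (D b x) = D b (D a x))
    (hpar : ∀ a, h.map (D a) = -((Γ a)ᵀ * h + h * Γ a)) (a b : ι) :
    (algCurvature D Γ a b)ᵀ * h = -(h * algCurvature D Γ a b) := by
  have hc := derivation_map_comm (hD a b) h
  rw [hpar a, hpar b] at hc
  simp only [derivation_map_neg, derivation_map_add, derivation_map_mul, hpar] at hc
  rw [← sub_eq_zero] at hc
  have ht : ∀ (d : Derivation ℝ 𝒜 𝒜) (A : Matrix ι ι 𝒜), Aᵀ.map d = (A.map d)ᵀ := fun d A => rfl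
  simp only [ht] at hc
  rw [← sub_eq_zero, ← neg_eq_zero, ← hc]
  simp only [algCurvature, Matrix.transpose_add, Matrix.transpose_sub, Matrix.transpose_mul]
  noncomm_ring

/-- Multiplication by the parallel h commutes with covariant differentiation, so the antisymmetry of
h times the curvature passes to its covariant derivative. -/
theorem mul_algCurvatureDeriv_antisymm (hD : ∀ a b x, D a (D b x) = D b (D a x))
    (hsym : hᵀ = h) (hpar : ∀ a, h.map (D a) = -((Γ a)ᵀ * h + h * Γ a)) (a b c : ι) :
    (h * algCurvatureDeriv D Γ a b c)ᵀ = -(h * algCurvatureDeriv D Γ a b c) := by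
  have hW : ∀ b c, (h * algCurvature D Γ b c)ᵀ = -(h * algCurvature D Γ b c) := fun b c => by
    rw [Matrix.transpose_mul, hsym, mul_algCurvature_antisymm hD hpar]
  have key : h * algCurvatureDeriv D Γ a b c
      = (h * algCurvature D Γ b c).map (D a) + (Γ a)ᵀ * (h * algCurvature D Γ b c)
        + (h * algCurvature D Γ b c) * Γ a
        - ∑ m, Γ a b m • (h * algCurvature D Γ m c)
        - ∑ m, Γ a c m • (h * algCurvature D Γ b m) := by
    simp only [← Matrix.mul_smul, ← Finset.mul_sum]
    rw [derivation_map_mul, hpar]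
    unfold algCurvatureDeriv
    noncomm_ring
  have ht : ∀ (d : Derivation ℝ 𝒜 𝒜) (A : Matrix ι ι 𝒜), (A.map d)ᵀ = Aᵀ.map d := fun d A => rfl
  rw [key]
  simp only [Matrix.transpose_sub, Matrix.transpose_add, Matrix.transpose_sum,
    Matrix.transpose_smul, ht, hW]
  have h1 : ((Γ a)ᵀ * (h * algCurvature D Γ b c))ᵀ = -(h * algCurvature D Γ b c * Γ a) := by
    rw [Matrix.transpose_mul, hW, Matrix.transpose_transpose, Matrix.neg_mul]
  have h2 : (h * algCurvature D Γ b c * Γ a)ᵀ = -((Γ a)ᵀ * (h * algCurvature D Γ b c)) := by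
    rw [Matrix.transpose_mul, hW, Matrix.mul_neg]
  rw [h1, h2, derivation_map_neg]
  simp only [smul_neg, Finset.sum_neg_distrib]
  noncomm_ring

/-- The derivative of a metric trace. -/
theorem trace_mul_algCovDeriv (hpar : ∀ a, h.map (D a) = -((Γ a)ᵀ * h + h * Γ a))
    (S : Matrix ι ι 𝒜) (a : ι) : (h * algCovDeriv D Γ S a).trace = D a (h * S).trace := by
  rw [derivation_trace, derivation_map_mul, hpar, algCovDeriv]
  have h1 : (h * (S * (Γ a)ᵀ)).trace = ((Γ a)ᵀ * h * S).trace := by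
    rw [← Matrix.mul_assoc, Matrix.trace_mul_comm, Matrix.mul_assoc]
  simp only [Matrix.mul_sub, Matrix.neg_mul, Matrix.add_mul, Matrix.trace_add, Matrix.trace_sub,
    Matrix.trace_neg, h1, Matrix.mul_assoc]
  ring

/-- The contracted second Bianchi identity. -/
theorem algRicci_contracted_bianchi (hD : ∀ a b x, D a (D b x) = D b (D a x))
    (hΓ : ∀ a b c, Γ a b c = Γ b a c) (hsym : hᵀ = h)
    (hpar : ∀ a, h.map (D a) = -((Γ a)ᵀ * h + h * Γ a)) (c : ι) :
    2 * ∑ a, ∑ d, h a d * algCovDeriv D Γ (algRicci D Γ) a c d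
      = D c (h * algRicci D Γ).trace := by
  have hN : ∀ a b c d e, (h * algCurvatureDeriv D Γ a b c) d e
      = -(h * algCurvatureDeriv D Γ a b c) e d := fun a b c d e => by
    have := congrFun (congrFun (mul_algCurvatureDeriv_antisymm (Γ := Γ) hD hsym hpar a b c) e) d
    simpa using this
  have hsw : ∀ a b c, algCurvatureDeriv D Γ a b c = -algCurvatureDeriv D Γ a c b := fun a b c => by
    have h1 : ∀ b c : ι, ∑ m, Γ a b m • algCurvature D Γ m c
      = -∑ m, Γ a b m • algCurvature D Γ c m := fun b c => by
      rw [← Finset.sum_neg_distrib]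
      exact Finset.sum_congr rfl fun m _ => by rw [algCurvature_swap, smul_neg]
    unfold algCurvatureDeriv
    rw [h1 b c, h1 c b, algCurvature_swap b c, derivation_map_neg]
    noncomm_ring
  -- The second Bianchi identity with its upper index raised by h, traced twice. By antisymmetry
  -- each of the first two terms becomes minus the divergence of Ricci; the third is the derivative
  -- of the scalar curvature.
  have hcyc : ∑ a, ∑ b, ((h * algCurvatureDeriv D Γ a b c) b a
      + (h * algCurvatureDeriv D Γ b c a) b a + (h * algCurvatureDeriv D Γ c a b) b a) = 0 := by
    refine Finset.sum_eq_zero fun a _ => Finset.sum_eq_zero fun b _ => ?_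
    rw [← Matrix.add_apply, ← Matrix.add_apply, ← Matrix.mul_add, ← Matrix.mul_add,
      algCurvatureDeriv_cyclic hD hΓ, Matrix.mul_zero, Matrix.zero_apply]
  have t1 : ∑ a, ∑ b, (h * algCurvatureDeriv D Γ a b c) b a
      = -∑ a, ∑ d, h a d * algCovDeriv D Γ (algRicci D Γ) a c d := by
    simp only [← algCurvatureDeriv_trace, Finset.mul_sum]
    rw [← Finset.sum_neg_distrib]
    refine Finset.sum_congr rfl fun a _ => ?_
    rw [Finset.sum_comm, ← Finset.sum_neg_distrib]
    refine Finset.sum_congr rfl fun b _ => ?_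
    rw [hN, Matrix.mul_apply]
  have t2 : ∑ a, ∑ b, (h * algCurvatureDeriv D Γ b c a) b a
      = -∑ a, ∑ d, h a d * algCovDeriv D Γ (algRicci D Γ) a c d := by
    simp only [← algCurvatureDeriv_trace, Finset.mul_sum]
    rw [← Finset.sum_neg_distrib, Finset.sum_comm]
    refine Finset.sum_congr rfl fun a _ => ?_
    rw [Finset.sum_comm, ← Finset.sum_neg_distrib]
    refine Finset.sum_congr rfl fun b _ => ?_
    rw [hsw, Matrix.mul_neg, Matrix.neg_apply, Matrix.mul_apply]
  have t3 : ∑ a, ∑ b, (h * algCurvatureDeriv D Γ c a b) b a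
      = D c (h * algRicci D Γ).trace := by
    rw [← trace_mul_algCovDeriv hpar]
    have hs : ∀ i j, h i j = h j i := fun i j => congrFun (congrFun hsym j) i
    have : (h * algCovDeriv D Γ (algRicci D Γ) c).trace
        = ∑ b, ∑ d, h b d * algCovDeriv D Γ (algRicci D Γ) c b d := by
      simp only [Matrix.trace, Matrix.diag_apply, Matrix.mul_apply]
      rw [Finset.sum_comm]
      exact Finset.sum_congr rfl fun b _ => Finset.sum_congr rfl fun d _ => by rw [hs d b]
    rw [this, Finset.sum_comm]
    simp only [← algCurvatureDeriv_trace, Finset.mul_sum, Matrix.mul_apply]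
    exact Finset.sum_congr rfl fun b _ => Finset.sum_comm
  simp only [Finset.sum_add_distrib] at hcyc
  rw [t1, t2, t3] at hcyc
  linear_combination -hcyc

end AlgebraicCalculus

/-! ### Consequences of a parallel symmetric bivector, and the role of a time direction -/

section ParallelBivector

open Matrix

variable {ι 𝒜 : Type*} [CommRing 𝒜] [Algebra ℝ 𝒜] [Fintype ι]
  {D : ι → Derivation ℝ 𝒜 𝒜} {Γ : ι → Matrix ι ι 𝒜} {h : Matrix ι ι 𝒜}

theorem trace_mul_eq_sum {ι R : Type*} [Fintype ι] [CommRing R] {h : Matrix ι ι R}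
    (hsym : hᵀ = h) (S : Matrix ι ι R) :
    (h * S).trace = ∑ a, ∑ b, h a b * S a b := by
  have hs : ∀ i j, h i j = h j i := fun i j => congrFun (congrFun hsym j) i
  simp only [Matrix.trace, Matrix.diag_apply, Matrix.mul_apply]
  rw [Finset.sum_comm]
  exact Finset.sum_congr rfl fun b _ => Finset.sum_congr rfl fun d _ => by rw [hs d b]

theorem derivation_bivector (hpar : ∀ a, h.map (D a) = -((Γ a)ᵀ * h + h * Γ a)) (a b c : ι) :
    D a (h b c) = -(∑ m, Γ a m b * h m c + ∑ m, h b m * Γ a m c) := by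
  have := congrFun (congrFun (hpar a) b) c
  simpa [Matrix.mul_apply] using this

theorem algCovDeriv_apply (S : Matrix ι ι 𝒜) (a b c : ι) :
    algCovDeriv D Γ S a b c
      = D a (S b c) - ∑ m, Γ a b m * S m c - ∑ m, Γ a c m * S b m := by
  simp only [algCovDeriv, Matrix.sub_apply, Matrix.map_apply, Matrix.mul_apply,
    Matrix.transpose_apply, mul_comm (S b _)]

/-- The divergence of the Hessian. -/
theorem algHessian_divergence (hD : ∀ a b x, D a (D b x) = D b (D a x))
    (hΓ : ∀ a b c, Γ a b c = Γ b a c) (hsym : hᵀ = h)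
    (hpar : ∀ a, h.map (D a) = -((Γ a)ᵀ * h + h * Γ a)) (f : 𝒜) (c : ι) :
    ∑ a, ∑ d, h a d * algCovDeriv D Γ (algHessian D Γ f) a c d
      = D c (h * algHessian D Γ f).trace
        + ∑ b, algRicci D Γ c b * ∑ m, h b m * D m f := by
  have hs : ∀ i j, h i j = h j i := fun i j => congrFun (congrFun hsym j) i
  have hW : ∀ a d e, (h * algCurvature D Γ a c) d e = -(h * algCurvature D Γ a c) e d :=
    fun a d e => by
      have := congrFun (congrFun (mul_algCurvature_antisymm (Γ := Γ) hD hpar a c) d) e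
      rw [Matrix.neg_apply, ← hsym, ← Matrix.transpose_mul, Matrix.transpose_apply, hsym] at this
      rw [this, neg_neg]
  have h1 : ∀ a d, algCovDeriv D Γ (algHessian D Γ f) a c d
      = algCovDeriv D Γ (algHessian D Γ f) c a d - ∑ m, algCurvature D Γ a c d m * D m f :=
    fun a d => by linear_combination algHessian_commute hD hΓ f a d c
  -- Antisymmetry of h times the curvature moves the contraction onto the first and the upper
  -- curvature index, where it produces Ricci.
  have h2 : ∑ a, ∑ d, h a d * ∑ m, algCurvature D Γ a c d m * D m f
      = -∑ b, algRicci D Γ c b * ∑ m, h b m * D m f := by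
    calc ∑ a, ∑ d, h a d * ∑ m, algCurvature D Γ a c d m * D m f
        = ∑ a, ∑ m, (h * algCurvature D Γ a c) a m * D m f := by
          refine Finset.sum_congr rfl fun a _ => ?_
          simp only [Finset.mul_sum, Matrix.mul_apply, Finset.sum_mul]
          rw [Finset.sum_comm]
          exact Finset.sum_congr rfl fun _ _ => Finset.sum_congr rfl fun _ _ => by ring
      _ = -∑ a, ∑ m, ∑ d, h m d * algCurvature D Γ a c d a * D m f := by
          simp only [← Finset.sum_neg_distrib]
          refine Finset.sum_congr rfl fun a _ => Finset.sum_congr rfl fun m _ => ?_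
          rw [hW, Matrix.mul_apply, neg_mul, Finset.sum_mul, Finset.sum_neg_distrib]
      _ = _ := by
          congr 1
          simp only [algRicci, Finset.sum_mul, Finset.mul_sum]
          rw [Finset.sum_comm]
          calc ∑ m, ∑ a, ∑ d, h m d * algCurvature D Γ a c d a * D m f
              = ∑ m, ∑ d, ∑ a, h m d * algCurvature D Γ a c d a * D m f :=
                Finset.sum_congr rfl fun _ _ => Finset.sum_comm
            _ = ∑ d, ∑ m, ∑ a, h m d * algCurvature D Γ a c d a * D m f := Finset.sum_comm
            _ = _ := by
                refine Finset.sum_congr rfl fun d _ => ?_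
                exact Finset.sum_congr rfl fun m _ => Finset.sum_congr rfl fun a _ => by
                  rw [hs d m]; ring
  rw [← trace_mul_algCovDeriv hpar, trace_mul_eq_sum hsym]
  simp only [h1, mul_sub, Finset.sum_sub_distrib]
  rw [h2]
  ring

/-- The derivative of `|∇f|²`. -/
theorem algHessian_grad (hsym : hᵀ = h)
    (hpar : ∀ a, h.map (D a) = -((Γ a)ᵀ * h + h * Γ a)) (f : 𝒜) (c : ι) :
    D c (∑ l, ∑ m, h l m * D l f * D m f)
      = 2 * ∑ l, algHessian D Γ f c l * ∑ m, h l m * D m f := by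
  have hs : ∀ i j, h i j = h j i := fun i j => congrFun (congrFun hsym j) i
  have e1 : ∑ l, ∑ m, D c (h l m) * D l f * D m f
      = -(2 * ∑ l, ∑ m, ∑ k, Γ c l k * h l m * D k f * D m f) := by
    have a1 : ∑ l, ∑ m, (∑ k, Γ c k l * h k m) * D l f * D m f
        = ∑ l, ∑ m, ∑ k, Γ c l k * h l m * D k f * D m f := by
      calc ∑ l, ∑ m, (∑ k, Γ c k l * h k m) * D l f * D m f
          = ∑ l, ∑ k, ∑ m, Γ c k l * h k m * D l f * D m f := by
            refine Finset.sum_congr rfl fun l _ => ?_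
            rw [Finset.sum_comm]
            simp only [Finset.sum_mul]
        _ = ∑ k, ∑ l, ∑ m, Γ c k l * h k m * D l f * D m f := Finset.sum_comm
        _ = _ := Finset.sum_congr rfl fun k _ => Finset.sum_comm
    have a2 : ∑ l, ∑ m, (∑ k, h l k * Γ c k m) * D l f * D m f
        = ∑ l, ∑ m, ∑ k, Γ c l k * h l m * D k f * D m f := by
      rw [← a1, Finset.sum_comm]
      refine Finset.sum_congr rfl fun l _ => Finset.sum_congr rfl fun m _ => ?_
      simp only [Finset.sum_mul]
      exact Finset.sum_congr rfl fun k _ => by rw [hs m k]; ring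
    simp only [derivation_bivector hpar, neg_mul, add_mul, Finset.sum_neg_distrib,
      Finset.sum_add_distrib]
    rw [a1, a2]; ring
  have e2 : ∑ l, ∑ m, h l m * D l f * D c (D m f) = ∑ l, ∑ m, h l m * D c (D l f) * D m f := by
    rw [Finset.sum_comm]
    exact Finset.sum_congr rfl fun l _ => Finset.sum_congr rfl fun m _ => by rw [hs m l]; ring
  have e3 : ∑ l, algHessian D Γ f c l * ∑ m, h l m * D m f
      = ∑ l, ∑ m, h l m * D c (D l f) * D m f
        - ∑ l, ∑ m, ∑ k, Γ c l k * h l m * D k f * D m f := by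
    simp only [← Finset.sum_sub_distrib, algHessian, Finset.mul_sum]
    refine Finset.sum_congr rfl fun l _ => Finset.sum_congr rfl fun m _ => ?_
    rw [sub_mul, Finset.sum_mul]
    congr 1
    · ring
    · exact Finset.sum_congr rfl fun k _ => by ring
  have e4 : D c (∑ l, ∑ m, h l m * D l f * D m f)
      = ∑ l, ∑ m, D c (h l m) * D l f * D m f + ∑ l, ∑ m, h l m * D c (D l f) * D m f
        + ∑ l, ∑ m, h l m * D l f * D c (D m f) := by
    simp only [map_sum, Derivation.leibniz, smul_eq_mul, ← Finset.sum_add_distrib]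
    exact Finset.sum_congr rfl fun l _ => Finset.sum_congr rfl fun m _ => by ring
  rw [e4, e1, e2, e3]; ring

/-- The curvature is trace free if it takes values in the range of a parallel bivector. -/
theorem algCurvature_trace (hD : ∀ a b x, D a (D b x) = D b (D a x))
    (hsym : hᵀ = h) (hpar : ∀ a, h.map (D a) = -((Γ a)ᵀ * h + h * Γ a))
    {K : Matrix ι ι 𝒜} (hK : Kᵀ = K) {a b : ι}
    (hR : algCurvature D Γ a b * (K * h) = algCurvature D Γ a b) :
    (algCurvature D Γ a b).trace = 0 := by
  have h1 : (algCurvature D Γ a b).trace = (h * algCurvature D Γ a b * K).trace := by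
    conv_lhs => rw [← hR]
    rw [← Matrix.mul_assoc, Matrix.trace_mul_comm, Matrix.mul_assoc]
  -- The trace of an antisymmetric matrix (h times the curvature) against the symmetric K equals its
  -- own negative.
  have h2 : (h * algCurvature D Γ a b * K).trace = -(h * algCurvature D Γ a b * K).trace := by
    conv_lhs => rw [← Matrix.trace_transpose]
    rw [Matrix.transpose_mul, Matrix.transpose_mul, hsym, hK, mul_algCurvature_antisymm hD hpar,
      Matrix.mul_neg, Matrix.trace_neg, Matrix.trace_mul_comm]
  rw [h1]
  apply two_mul_cancel_of_algebra
  linear_combination h2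

/-- Tracing the first Bianchi identity shows that the antisymmetric part of Ricci is governed by the
trace of the curvature. -/
theorem algRicci_symm (hΓ : ∀ a b c, Γ a b c = Γ b a c)
    (htr : ∀ a b, (algCurvature D Γ a b).trace = 0) (a b : ι) :
    algRicci D Γ a b = algRicci D Γ b a := by
  have h1 : ∑ p, (algCurvature D Γ p a b p + algCurvature D Γ a b p p + algCurvature D Γ b p a p)
      = 0 := Finset.sum_eq_zero fun p _ => algCurvature_bianchi_first hΓ p a b p
  have h2 : ∑ p, algCurvature D Γ b p a p = -algRicci D Γ b a := by
    rw [algRicci, ← Finset.sum_neg_distrib]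
    exact Finset.sum_congr rfl fun p _ => by rw [algCurvature_swap, Matrix.neg_apply]
  have h3 : ∑ p, algCurvature D Γ a b p p = 0 := htr a b
  rw [Finset.sum_add_distrib, Finset.sum_add_distrib, h2, h3] at h1
  have h4 : ∑ p, algCurvature D Γ p a b p = algRicci D Γ a b := rfl
  linear_combination h1 - h4

theorem algHessian_symm (hD : ∀ a b x, D a (D b x) = D b (D a x))
    (hΓ : ∀ a b c, Γ a b c = Γ b a c) (f : 𝒜) (a b : ι) :
    algHessian D Γ f a b = algHessian D Γ f b a := by
  simp only [algHessian, hD a b, hΓ a b]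

variable (D Γ) in
/-- The modified Ricci tensor `R_{ab} - ∇_a ∇_b f`. -/
def algModifiedRicci (f : 𝒜) : Matrix ι ι 𝒜 :=
  algRicci D Γ - algHessian D Γ f

/-- The third derivatives of f cancel between the gradient of the trace and the divergence of the
Hessian, leaving only a Ricci term in ∇f. -/
theorem algModifiedRicci_divergence (hD : ∀ a b x, D a (D b x) = D b (D a x))
    (hΓ : ∀ a b c, Γ a b c = Γ b a c) (hsym : hᵀ = h)
    (hpar : ∀ a, h.map (D a) = -((Γ a)ᵀ * h + h * Γ a)) (f : 𝒜) (c : ι) :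
    2 * (D c (h * algModifiedRicci D Γ f).trace
        - ∑ a, ∑ d, h a d * algCovDeriv D Γ (algModifiedRicci D Γ f) a c d)
      = D c (h * algRicci D Γ).trace
        + 2 * ∑ b, algRicci D Γ c b * ∑ m, h b m * D m f := by
  have h1 := algRicci_contracted_bianchi hD hΓ hsym hpar c
  have h2 := algHessian_divergence hD hΓ hsym hpar f c
  simp only [algModifiedRicci, algCovDeriv_sub, Matrix.trace_sub, map_sub,
    Matrix.sub_apply, mul_sub, Finset.sum_sub_distrib]
  linear_combination 2 * h2 - h1

/-! #### A time direction -/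

variable {o : ι}

/-- The row `R_{0c}` of the Ricci tensor when `Γ_{0c}^p = - S_c^p`. -/
theorem algRicci_time (hΓ : ∀ a b c, Γ a b c = Γ b a c)
    (hpar : ∀ a, h.map (D a) = -((Γ a)ᵀ * h + h * Γ a))
    (hΓo : ∀ a b, Γ a b o = 0) (ho : ∀ a, h o a = 0) (hsym : hᵀ = h)
    (S : Matrix ι ι 𝒜) {c : ι} (htr : (algCurvature D Γ o c).trace = 0)
    (hsp : ∀ m, m ≠ o → ∀ p, Γ o m p = -∑ l, h p l * S m l)
    (hc : ∀ p, Γ o c p = -∑ l, h p l * S c l) :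
    algRicci D Γ o c = D c (h * S).trace - ∑ a, ∑ d, h a d * algCovDeriv D Γ S a c d := by
  have h1 : ∑ p, Γ o p p = -(h * S).trace := by
    rw [trace_mul_eq_sum hsym, ← Finset.sum_neg_distrib]
    refine Finset.sum_congr rfl fun p _ => ?_
    by_cases hp : p = o
    · subst hp; simp [hΓo, ho]
    · exact hsp p hp p
  -- A commutator has trace zero, so vanishing of the curvature trace says ∂_0 Γ_{cp}^p = ∂_c
  -- Γ_{0p}^p.
  have h2 : ∑ p, D o (Γ p c p) = -D c (h * S).trace := by
    have h3 : (algCurvature D Γ o c).trace = ∑ p, D o (Γ c p p) - ∑ p, D c (Γ o p p) := by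
      have h4 : (Γ c * Γ o - Γ o * Γ c).trace = 0 := by
        rw [Matrix.trace_sub, Matrix.trace_mul_comm, sub_self]
      rw [algCurvature, Matrix.trace_add, h4]
      simp [Matrix.trace]
    rw [htr, ← map_sum (D c), h1, map_neg] at h3
    simp only [hΓ _ c]
    linear_combination -h3
  have h5 : algRicci D Γ o c
      = ∑ p, (D p (Γ o c p) + ∑ m, Γ o c m * Γ p m p - ∑ m, Γ p c m * Γ o m p)
        - ∑ p, D o (Γ p c p) := by
    rw [algRicci, ← Finset.sum_sub_distrib]
    refine Finset.sum_congr rfl fun p _ => ?_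
    simp only [algCurvature, Matrix.add_apply, Matrix.sub_apply, Matrix.map_apply,
      Matrix.mul_apply]
    ring
  have h6 : ∑ p, (D p (Γ o c p) + ∑ m, Γ o c m * Γ p m p - ∑ m, Γ p c m * Γ o m p)
      = -∑ a, ∑ d, h a d * algCovDeriv D Γ S a c d := by
    rw [← Finset.sum_neg_distrib]
    refine Finset.sum_congr rfl fun p _ => ?_
    have a1 : D p (Γ o c p) = ∑ l, (∑ m, Γ p m p * h m l) * S c l
        + ∑ l, (∑ m, h p m * Γ p m l) * S c l - ∑ l, h p l * D p (S c l) := by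
      rw [hc p, map_neg, map_sum, ← Finset.sum_add_distrib, ← Finset.sum_sub_distrib,
        ← Finset.sum_neg_distrib]
      refine Finset.sum_congr rfl fun l _ => ?_
      rw [Derivation.leibniz, derivation_bivector hpar]
      simp only [smul_eq_mul]; ring
    have a2 : ∑ m, Γ o c m * Γ p m p = -∑ l, (∑ m, Γ p m p * h m l) * S c l := by
      simp only [hc, neg_mul, Finset.sum_mul, Finset.sum_neg_distrib]
      rw [Finset.sum_comm]
      congr 1
      exact Finset.sum_congr rfl fun l _ => Finset.sum_congr rfl fun m _ => by ring
    have a3 : ∑ m, Γ p c m * Γ o m p = -∑ l, h p l * ∑ m, Γ p c m * S m l := by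
      -- The summand m = o vanishes because Γ_{pc}^o = 0. Hence the formula for Γ_{om}^p is needed
      -- only for m ≠ o, and the lemma can be used before Γ_{00}^p is understood.
      have : ∀ m, Γ p c m * Γ o m p = -∑ l, h p l * (Γ p c m * S m l) := fun m => by
        by_cases hm : m = o
        · subst hm; simp [hΓo]
        · rw [hsp m hm, mul_neg, Finset.mul_sum]
          congr 1
          exact Finset.sum_congr rfl fun l _ => by ring
      simp only [this, Finset.sum_neg_distrib, Finset.mul_sum]
      rw [Finset.sum_comm]
    have a4 : ∑ l, (∑ m, h p m * Γ p m l) * S c l = ∑ l, h p l * ∑ m, Γ p l m * S c m := by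
      simp only [Finset.sum_mul, Finset.mul_sum]
      rw [Finset.sum_comm]
      exact Finset.sum_congr rfl fun l _ => Finset.sum_congr rfl fun m _ => by ring
    rw [a1, a2, a3, a4]
    simp only [algCovDeriv_apply, mul_sub, Finset.sum_sub_distrib]
    ring
  rw [h5, h6, h2]; ring

/-- If `Γ_{0c}^p = - S_c^p` then `S_{0c} = - ∂_c P`, where `2 P = - R + 2 ∂_t f - |∇f|²`. -/
theorem algModifiedRicci_time (hD : ∀ a b x, D a (D b x) = D b (D a x))
    (hΓ : ∀ a b c, Γ a b c = Γ b a c)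
    (hpar : ∀ a, h.map (D a) = -((Γ a)ᵀ * h + h * Γ a))
    (hΓo : ∀ a b, Γ a b o = 0) (ho : ∀ a, h o a = 0) (hsym : hᵀ = h) {f P : 𝒜}
    (hP : 2 * P = -(h * algRicci D Γ).trace + 2 * D o f - ∑ l, ∑ m, h l m * D l f * D m f)
    {c : ι} (htr : (algCurvature D Γ o c).trace = 0)
    (hsp : ∀ m, m ≠ o → ∀ p, Γ o m p = -∑ l, h p l * algModifiedRicci D Γ f m l)
    (hc : ∀ p, Γ o c p = -∑ l, h p l * algModifiedRicci D Γ f c l) :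
    algModifiedRicci D Γ f o c = -D c P := by
  have hs : ∀ i j, h i j = h j i := fun i j => congrFun (congrFun hsym j) i
  have h1 := algRicci_time hΓ hpar hΓo ho hsym _ htr hsp hc
  have h2 := algModifiedRicci_divergence hD hΓ hsym hpar f c
  have h3 := algHessian_grad (Γ := Γ) hsym hpar f c
  have h4 : algModifiedRicci D Γ f o c
      = algRicci D Γ o c - (D o (D c f) - ∑ m, Γ o c m * D m f) := rfl
  have h5 : ∑ m, Γ o c m * D m f
      = -∑ b, algRicci D Γ c b * ∑ m, h b m * D m f
        + ∑ l, algHessian D Γ f c l * ∑ m, h l m * D m f := by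
    have : ∑ m, Γ o c m * D m f
        = -∑ l, algModifiedRicci D Γ f c l * ∑ m, h l m * D m f := by
      simp only [hc, neg_mul, Finset.sum_neg_distrib, Finset.sum_mul, Finset.mul_sum]
      rw [Finset.sum_comm]
      congr 1
      exact Finset.sum_congr rfl fun l _ => Finset.sum_congr rfl fun m _ => by rw [hs l m]; ring
    rw [this]
    simp only [algModifiedRicci, Matrix.sub_apply, sub_mul, Finset.sum_sub_distrib]
    ring
  have h6 := congrArg (D c) hP
  have h7 : ∀ x, D c (2 * x) = 2 * D c x := fun x => by rw [two_mul, map_add, two_mul]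
  simp only [map_sub, map_add, h7, map_neg, hD c o] at h6
  apply two_mul_cancel_of_algebra
  rw [h4]
  -- The Ricci terms of `h2` and `h5` cancel; what remains is ∂_c of R + |∇f|² - 2 ∂_0 f, that is,
  -- of -2P.
  linear_combination 2 * h1 + h2 + 2 * h5 - h3 + h6

/-- The evolution of `Γ_{0a}^k`. -/
theorem algConnection_time_evolution (hD : ∀ a b x, D a (D b x) = D b (D a x))
    (hΓ : ∀ a b c, Γ a b c = Γ b a c) (hsym : hᵀ = h)
    (hpar : ∀ a, h.map (D a) = -((Γ a)ᵀ * h + h * Γ a))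
    {S : Matrix ι ι 𝒜} (hS : ∀ a b, S a b = S b a) {P : 𝒜} (hSP : ∀ c, S o c = -D c P)
    (hA : ∀ a p, Γ o a p = -∑ l, h p l * S a l) (a k : ι) :
    D o (Γ o a k) = -∑ l, h k l * (algCovDeriv D Γ S o a l + algCovDeriv D Γ S a o l
      - algCovDeriv D Γ S l o a) := by
  have hs : ∀ i j, h i j = h j i := fun i j => congrFun (congrFun hsym j) i
  -- The terms that are not visibly symmetric in a and l are the contractions of Γ_{a0}^m with S;
  -- after substituting `hA` they have the form S h S, which is symmetric.
  have h1 : ∀ l, algCovDeriv D Γ S a o l = algCovDeriv D Γ S l o a := fun l => by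
    rw [algCovDeriv_apply, algCovDeriv_apply, hSP, hSP, map_neg, map_neg, hD a l]
    have : ∑ m, Γ a o m * S m l = ∑ m, Γ l o m * S m a := by
      simp only [hΓ _ o, hA, neg_mul, Finset.sum_neg_distrib, Finset.sum_mul]
      rw [Finset.sum_comm]
      congr 1
      exact Finset.sum_congr rfl fun r _ => Finset.sum_congr rfl fun m _ => by
        rw [hs m r, hS a r, hS m l]; ring
    rw [this]
    simp only [hΓ a l]
  have h2 : D o (Γ o a k) = ∑ l, (∑ m, Γ o m k * h m l) * S a l
      + ∑ l, (∑ m, h k m * Γ o m l) * S a l - ∑ l, h k l * D o (S a l) := by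
    rw [hA a k, map_neg, map_sum, ← Finset.sum_add_distrib, ← Finset.sum_sub_distrib,
      ← Finset.sum_neg_distrib]
    refine Finset.sum_congr rfl fun l _ => ?_
    rw [Derivation.leibniz, derivation_bivector hpar]
    simp only [smul_eq_mul]; ring
  have h3 : ∑ l, (∑ m, h k m * Γ o m l) * S a l = ∑ l, h k l * ∑ m, Γ o l m * S a m := by
    simp only [Finset.sum_mul, Finset.mul_sum]
    rw [Finset.sum_comm]
    exact Finset.sum_congr rfl fun l _ => Finset.sum_congr rfl fun m _ => by ring
  -- Both sides equal -∑ Γ_{0m}^k Γ_{0a}^m: `hA` is applied to one factor on the left and to the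
  -- other on the right.
  have h4 : ∑ l, (∑ m, Γ o m k * h m l) * S a l = ∑ l, h k l * ∑ m, Γ o a m * S m l := by
    have b1 : ∑ l, (∑ m, Γ o m k * h m l) * S a l = -∑ m, Γ o m k * Γ o a m := by
      simp only [hA a, mul_neg, Finset.sum_neg_distrib, neg_neg, Finset.sum_mul, Finset.mul_sum]
      rw [Finset.sum_comm]
      exact Finset.sum_congr rfl fun r _ => Finset.sum_congr rfl fun m _ => by ring
    have b2 : ∑ l, h k l * ∑ m, Γ o a m * S m l = -∑ m, Γ o m k * Γ o a m := by
      simp only [hA _ k, neg_mul, Finset.sum_neg_distrib, neg_neg, Finset.sum_mul, Finset.mul_sum]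
      rw [Finset.sum_comm]
      exact Finset.sum_congr rfl fun r _ => Finset.sum_congr rfl fun m _ => by ring
    rw [b1, b2]
  have h5 : ∀ l, h k l * (algCovDeriv D Γ S o a l + algCovDeriv D Γ S a o l
      - algCovDeriv D Γ S l o a)
      = h k l * D o (S a l) - h k l * ∑ m, Γ o a m * S m l - h k l * ∑ m, Γ o l m * S a m :=
    fun l => by rw [h1 l, algCovDeriv_apply]; ring
  simp only [h5, Finset.sum_sub_distrib]
  rw [h2, h3, h4]; ring

end ParallelBivector

/-! ### The space-time connection of a modified Ricci flow -/

section SpacetimeAlgebra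

open Matrix

/-- The spacetime matrix with vanishing time row and time column. -/
def padMatrix {n : ℕ} {R : Type*} [Zero R] (h : Matrix (Fin n) (Fin n) R) :
    Matrix (Fin (n + 1)) (Fin (n + 1)) R :=
  fun a b => Fin.cases 0 (fun i => Fin.cases 0 (fun j => h i j) b) a

section

variable {n : ℕ} {R : Type*} [CommRing R] (h k : Matrix (Fin n) (Fin n) R)

@[simp] theorem padMatrix_zero_left (b : Fin (n + 1)) : padMatrix h 0 b = 0 := rfl

@[simp] theorem padMatrix_zero_right (a : Fin (n + 1)) : padMatrix h a 0 = 0 := by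
  refine Fin.cases rfl (fun i => rfl) a

@[simp] theorem padMatrix_succ (i j : Fin n) : padMatrix h i.succ j.succ = h i j := rfl

theorem padMatrix_mul : padMatrix h * padMatrix k = padMatrix (h * k) := by
  ext a b
  rw [Matrix.mul_apply, Fin.sum_univ_succ]
  refine Fin.cases (by simp) (fun i => ?_) a
  refine Fin.cases (by simp) (fun j => ?_) b
  simp [Matrix.mul_apply]

theorem padMatrix_transpose : (padMatrix h)ᵀ = padMatrix hᵀ := by
  ext a b
  refine Fin.cases (by simp) (fun i => ?_) a
  refine Fin.cases (by simp) (fun j => ?_) b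
  simp

theorem mul_padMatrix_one {A : Matrix (Fin (n + 1)) (Fin (n + 1)) R} (hA : ∀ a, A a 0 = 0) :
    A * padMatrix 1 = A := by
  ext a b
  rw [Matrix.mul_apply, Fin.sum_univ_succ]
  refine Fin.cases (by simp [hA]) (fun j => ?_) b
  simp [Matrix.one_apply]

end

variable {n : ℕ} {𝒜 : Type*} [CommRing 𝒜] [Algebra ℝ 𝒜]

/-- A solution of the modified Ricci flow with its spacetime connection, in coordinates and over
an algebra of functions: `G` is the metric, `h` its inverse, `γ` its Levi-Civita connection, and
`Γ` the spacetime connection with potential `P`. -/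
structure IsFlowConnection (D : Fin (n + 1) → Derivation ℝ 𝒜 𝒜) (G h : Matrix (Fin n) (Fin n) 𝒜)
    (γ : Fin n → Matrix (Fin n) (Fin n) 𝒜)
    (Γ : Fin (n + 1) → Matrix (Fin (n + 1)) (Fin (n + 1)) 𝒜) (f P : 𝒜) : Prop where
  comm : ∀ a b x, D a (D b x) = D b (D a x)
  metric_symm : Gᵀ = G
  inv_mul : h * G = 1
  leviCivita : ∀ i j k, 2 * γ i j k
    = ∑ l, h k l * (D i.succ (G j l) + D j.succ (G i l) - D l.succ (G i j))
  flow : ∀ i j, D 0 (G i j) = -2 * algRicci (fun i => D i.succ) γ i j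
    + 2 * algHessian (fun i => D i.succ) γ f i j
  conn_time : ∀ a b, Γ a b 0 = 0
  conn_space : ∀ i j k : Fin n, Γ i.succ j.succ k.succ = γ i j k
  conn_mixed_left : ∀ i k : Fin n, Γ i.succ 0 k.succ
    = -∑ l, h k l * algRicci (fun i => D i.succ) γ i l
      + ∑ l, h k l * algHessian (fun i => D i.succ) γ f i l
  conn_mixed_right : ∀ i k : Fin n, Γ 0 i.succ k.succ
    = -∑ l, h k l * algRicci (fun i => D i.succ) γ i l
      + ∑ l, h k l * algHessian (fun i => D i.succ) γ f i l
  conn_zero : ∀ k : Fin n, Γ 0 0 k.succ = ∑ l, h k l * D l.succ P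
  potential : 2 * P = -∑ i, ∑ j, h i j * algRicci (fun i => D i.succ) γ i j + 2 * D 0 f
    - ∑ i, ∑ j, h i j * D i.succ f * D j.succ f

namespace IsFlowConnection

variable {D : Fin (n + 1) → Derivation ℝ 𝒜 𝒜} {G h : Matrix (Fin n) (Fin n) 𝒜}
  {γ : Fin n → Matrix (Fin n) (Fin n) 𝒜}
  {Γ : Fin (n + 1) → Matrix (Fin (n + 1)) (Fin (n + 1)) 𝒜} {f P : 𝒜}

theorem two_smul_cancel {ι : Type*} {A B : Matrix ι ι 𝒜} (h : (2 : 𝒜) • A = (2 : 𝒜) • B) :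
    A = B := by
  ext i j
  exact two_mul_cancel_of_algebra (congrFun (congrFun h i) j)

variable (H : IsFlowConnection D G h γ Γ f P)
include H

theorem mul_inv : G * h = 1 := mul_eq_one_comm.mp H.inv_mul

theorem inv_symm : hᵀ = h := by
  have h1 : hᵀ * G = 1 := by
    rw [← H.metric_symm, ← Matrix.transpose_mul, H.mul_inv, Matrix.transpose_one]
  calc hᵀ = hᵀ * (G * h) := by rw [H.mul_inv, Matrix.mul_one]
    _ = h := by rw [← Matrix.mul_assoc, h1, Matrix.one_mul]

theorem inv_deriv (a : Fin (n + 1)) : h.map (D a) = -(h * G.map (D a) * h) := by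
  have h1 : (h * G).map (D a) = 0 := by
    rw [H.inv_mul]
    ext i j
    by_cases hij : i = j
    · subst hij; simp
    · simp [hij]
  rw [derivation_map_mul] at h1
  calc h.map (D a) = h.map (D a) * (G * h) := by rw [H.mul_inv, Matrix.mul_one]
    _ = (h.map (D a) * G + h * G.map (D a)) * h - h * G.map (D a) * h := by noncomm_ring
    _ = _ := by rw [h1]; noncomm_ring

/-- The matrices `∂_i g_{jl} + ∂_j g_{il} - ∂_l g_{ij}`. -/
theorem leviCivita_matrix (i : Fin n) :
    (2 : 𝒜) • γ i = (Matrix.of fun j l =>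
      D i.succ (G j l) + D j.succ (G i l) - D l.succ (G i j)) * h := by
  ext j k
  rw [Matrix.smul_apply, smul_eq_mul, H.leviCivita, Matrix.mul_apply]
  have hs : ∀ i j, h i j = h j i := fun i j => congrFun (congrFun H.inv_symm j) i
  exact Finset.sum_congr rfl fun l _ => by rw [hs k l, Matrix.of_apply, mul_comm]

theorem metric_deriv (i : Fin n) : G.map (D i.succ) = γ i * G + G * (γ i)ᵀ := by
  have hs : ∀ i j, G i j = G j i := fun i j => congrFun (congrFun H.metric_symm j) i
  have h1 : (2 : 𝒜) • (γ i * G) = Matrix.of fun j l =>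
      D i.succ (G j l) + D j.succ (G i l) - D l.succ (G i j) := by
    rw [← Matrix.smul_mul, H.leviCivita_matrix, Matrix.mul_assoc, H.inv_mul, Matrix.mul_one]
  have h2 : G * (γ i)ᵀ = (γ i * G)ᵀ := by rw [Matrix.transpose_mul, H.metric_symm]
  apply two_smul_cancel
  rw [smul_add, h2, ← Matrix.transpose_smul, h1]
  ext j l
  simp only [Matrix.smul_apply, Matrix.map_apply, Matrix.add_apply, Matrix.of_apply,
    Matrix.transpose_apply, smul_eq_mul]
  rw [hs l j]; ring

theorem inv_space_deriv (i : Fin n) : h.map (D i.succ) = -((γ i)ᵀ * h + h * γ i) := by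
  rw [H.inv_deriv, H.metric_deriv, Matrix.mul_add, Matrix.add_mul]
  have h1 : h * (γ i * G) * h = h * γ i := by
    rw [← Matrix.mul_assoc, Matrix.mul_assoc, H.mul_inv, Matrix.mul_one]
  have h2 : h * (G * (γ i)ᵀ) * h = (γ i)ᵀ * h := by
    rw [← Matrix.mul_assoc, H.inv_mul, Matrix.one_mul]
  rw [h1, h2, add_comm]

theorem space_conn_symm (i j k : Fin n) : γ i j k = γ j i k := by
  have hs : ∀ i j, G i j = G j i := fun i j => congrFun (congrFun H.metric_symm j) i
  apply two_mul_cancel_of_algebra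
  rw [H.leviCivita, H.leviCivita]
  exact Finset.sum_congr rfl fun l _ => by rw [hs i j]; ring

theorem conn_symm (a b c : Fin (n + 1)) : Γ a b c = Γ b a c := by
  refine Fin.cases ?_ (fun k => ?_) c
  · rw [H.conn_time, H.conn_time]
  · refine Fin.cases ?_ (fun i => ?_) a <;> refine Fin.cases ?_ (fun j => ?_) b
    · rfl
    · rw [H.conn_mixed_left, H.conn_mixed_right]
    · rw [H.conn_mixed_left, H.conn_mixed_right]
    · rw [H.conn_space, H.conn_space, H.space_conn_symm]

theorem curvature_time (a b c : Fin (n + 1)) : algCurvature D Γ a b c 0 = 0 := by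
  simp [algCurvature, Matrix.mul_apply, H.conn_time]

/-- Symbols with upper index 0 vanish, so the time index contributes neither to the trace nor to the
products. -/
theorem ricci_space (i j : Fin n) :
    algRicci D Γ i.succ j.succ = algRicci (fun i => D i.succ) γ i j := by
  unfold algRicci
  rw [Fin.sum_univ_succ, H.curvature_time, zero_add]
  refine Finset.sum_congr rfl fun p _ => ?_
  simp [algCurvature, Matrix.mul_apply, Fin.sum_univ_succ, H.conn_time, H.conn_space]

theorem hessian_space (i j : Fin n) :
    algHessian D Γ f i.succ j.succ = algHessian (fun i => D i.succ) γ f i j := by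
  simp [algHessian, Fin.sum_univ_succ, H.conn_time, H.conn_space]

theorem modifiedRicci_space (i j : Fin n) :
    algModifiedRicci D Γ f i.succ j.succ = algModifiedRicci (fun i => D i.succ) γ f i j := by
  simp only [algModifiedRicci, Matrix.sub_apply, H.ricci_space, H.hessian_space]

theorem metric_time_deriv :
    G.map (D 0) = -((2 : 𝒜) • algModifiedRicci (fun i => D i.succ) γ f) := by
  ext i j
  simp only [Matrix.map_apply, H.flow, algModifiedRicci, Matrix.neg_apply, Matrix.smul_apply,
    Matrix.sub_apply, smul_eq_mul]
  ring

/-- By the flow equation this tensor is -½ ∂_t g, so it inherits the symmetry of the metric. -/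
theorem space_modifiedRicci_symm : (algModifiedRicci (fun i => D i.succ) γ f)ᵀ
    = algModifiedRicci (fun i => D i.succ) γ f := by
  apply two_smul_cancel
  rw [← Matrix.transpose_smul, ← neg_inj, ← Matrix.transpose_neg, ← H.metric_time_deriv]
  conv_rhs => rw [← H.metric_symm]
  rfl

theorem inv_time_deriv :
    h.map (D 0) = (2 : 𝒜) • (h * algModifiedRicci (fun i => D i.succ) γ f * h) := by
  rw [H.inv_deriv, H.metric_time_deriv]
  simp

theorem conn_time_space (i k : Fin n) :
    Γ 0 i.succ k.succ = -∑ l, h k l * algModifiedRicci (fun i => D i.succ) γ f i l := by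
  rw [H.conn_mixed_right]
  simp only [algModifiedRicci, Matrix.sub_apply, mul_sub, Finset.sum_sub_distrib]
  ring

/-- In spatial directions this is metric compatibility. In the time direction the two mixed terms
each contribute half of ∂_t h = 2 h S h. The symbols Γ_{00}^k do not matter, since h annihilates the
time index. -/
theorem parallel (a : Fin (n + 1)) : (padMatrix h).map (D a)
    = -((Γ a)ᵀ * padMatrix h + padMatrix h * Γ a) := by
  ext b c
  simp only [Matrix.map_apply, Matrix.neg_apply, Matrix.add_apply, Matrix.mul_apply,
    Matrix.transpose_apply, Fin.sum_univ_succ, padMatrix_zero_left, padMatrix_zero_right]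
  refine Fin.cases ?_ (fun i => ?_) b
  · simp [H.conn_time]
  refine Fin.cases ?_ (fun j => ?_) c
  · simp [H.conn_time]
  simp only [padMatrix_succ, mul_zero, zero_mul, zero_add]
  refine Fin.cases ?_ (fun e => ?_) a
  · have h1 : D 0 (h i j) = 2 * (h * algModifiedRicci (fun i => D i.succ) γ f * h) i j :=
      congrFun (congrFun H.inv_time_deriv i) j
    have h2 : (Matrix.of fun m k => Γ 0 (Fin.succ m) (Fin.succ k))
        = -(algModifiedRicci (fun i => D i.succ) γ f * h) := by
      ext m k
      have hs : ∀ i j, h i j = h j i := fun i j => congrFun (congrFun H.inv_symm j) i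
      rw [Matrix.of_apply, H.conn_time_space, Matrix.neg_apply, Matrix.mul_apply]
      congr 1
      exact Finset.sum_congr rfl fun l _ => by rw [hs k l, mul_comm]
    have h3 : ∑ m : Fin n, Γ 0 m.succ i.succ * h m j
        = -(h * algModifiedRicci (fun i => D i.succ) γ f * h) i j := by
      have : ∑ m : Fin n, Γ 0 m.succ i.succ * h m j
        = ((Matrix.of fun m k => Γ 0 (Fin.succ m) (Fin.succ k))ᵀ * h) i j := by
        simp [Matrix.mul_apply]
      rw [this, h2, Matrix.transpose_neg, Matrix.transpose_mul, H.inv_symm,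
        H.space_modifiedRicci_symm, Matrix.neg_mul, Matrix.neg_apply]
    have h4 : ∑ m : Fin n, h i m * Γ 0 m.succ j.succ
        = -(h * algModifiedRicci (fun i => D i.succ) γ f * h) i j := by
      have : ∑ m : Fin n, h i m * Γ 0 m.succ j.succ
        = (h * (Matrix.of fun m k => Γ 0 (Fin.succ m) (Fin.succ k))) i j := by
        simp [Matrix.mul_apply]
      rw [this, h2, Matrix.mul_neg, Matrix.neg_apply, Matrix.mul_assoc]
    rw [h1, h3, h4]; ring
  · have := congrFun (congrFun (H.inv_space_deriv e) i) j
    simpa [Matrix.mul_apply, H.conn_space] using this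

theorem pad_symm : (padMatrix h)ᵀ = padMatrix h := by
  rw [padMatrix_transpose, H.inv_symm]

/-- The padded metric is a partial inverse of the padded h: their product is the projection onto
space. That projection fixes the curvature, which has no component with upper index 0. -/
theorem curvature_trace (a b : Fin (n + 1)) : (algCurvature D Γ a b).trace = 0 := by
  refine algCurvature_trace H.comm H.pad_symm H.parallel (K := padMatrix G) ?_ ?_
  · rw [padMatrix_transpose, H.metric_symm]
  · rw [padMatrix_mul, H.mul_inv, mul_padMatrix_one (H.curvature_time a b)]

theorem modifiedRicci_symm (a b : Fin (n + 1)) :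
    algModifiedRicci D Γ f a b = algModifiedRicci D Γ f b a := by
  simp only [algModifiedRicci, Matrix.sub_apply]
  rw [algRicci_symm H.conn_symm H.curvature_trace a b, algHessian_symm H.comm H.conn_symm f a b]

theorem potential_spacetime : 2 * P = -(padMatrix h * algRicci D Γ).trace + 2 * D 0 f
    - ∑ l, ∑ m, padMatrix h l m * D l f * D m f := by
  rw [H.potential, trace_mul_eq_sum H.pad_symm]
  simp [Fin.sum_univ_succ, H.ricci_space]

theorem conn_time_of_ne {m : Fin (n + 1)} (hm : m ≠ 0) (p : Fin (n + 1)) :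
    Γ 0 m p = -∑ l, padMatrix h p l * algModifiedRicci D Γ f m l := by
  obtain ⟨i, rfl⟩ := Fin.exists_succ_eq.mpr hm
  refine Fin.cases (by simp [H.conn_time]) (fun k => ?_) p
  simp [Fin.sum_univ_succ, H.conn_time_space, H.modifiedRicci_space]

/-- For spatial c, only the mixed symbols enter the hypotheses on Γ, so no knowledge of Γ_{00}^k is
required. -/
theorem modifiedRicci_time_space (i : Fin n) :
    algModifiedRicci D Γ f 0 i.succ = -D i.succ P :=
  algModifiedRicci_time H.comm H.conn_symm H.parallel H.conn_time (padMatrix_zero_left h) H.pad_symm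
    H.potential_spacetime (H.curvature_trace _ _) (fun _ hm => H.conn_time_of_ne hm)
    (H.conn_time_of_ne (Fin.succ_ne_zero i))

/-- The row m = 0 is where the prescribed Γ_{00}^k = ∇^k P is used: by the preceding formula for
S_{0l} it fits the same pattern as the mixed symbols. -/
theorem conn_time_row (m p : Fin (n + 1)) :
    Γ 0 m p = -∑ l, padMatrix h p l * algModifiedRicci D Γ f m l := by
  by_cases hm : m = 0
  · subst hm
    refine Fin.cases (by simp [H.conn_time]) (fun k => ?_) p
    simp [Fin.sum_univ_succ, H.conn_zero, H.modifiedRicci_time_space]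
  · exact H.conn_time_of_ne hm p

/-- With the full time row of the connection available, the same argument now also covers c = 0. -/
theorem modifiedRicci_time (c : Fin (n + 1)) : algModifiedRicci D Γ f 0 c = -D c P :=
  algModifiedRicci_time H.comm H.conn_symm H.parallel H.conn_time (padMatrix_zero_left h) H.pad_symm
    H.potential_spacetime (H.curvature_trace _ _) (fun m _ => H.conn_time_row m)
    (H.conn_time_row c)

/-- The evolution of the Levi-Civita connection. -/
theorem space_conn_evolution (i j k : Fin n) :
    D 0 (γ i j k) = -∑ l, h k l *
      (algCovDeriv (fun i => D i.succ) γ (algModifiedRicci (fun i => D i.succ) γ f) i j l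
        + algCovDeriv (fun i => D i.succ) γ (algModifiedRicci (fun i => D i.succ) γ f) j i l
        - algCovDeriv (fun i => D i.succ) γ (algModifiedRicci (fun i => D i.succ) γ f) l i j) := by
  have hs : ∀ i j, h i j = h j i := fun i j => congrFun (congrFun H.inv_symm j) i
  have hS' := H.space_modifiedRicci_symm
  have hG : ∀ a i j, D a (D 0 (G i j))
      = -(2 * D a (algModifiedRicci (fun i => D i.succ) γ f i j)) := fun a i j => by
    have h1 : D 0 (G i j) = -(2 * algModifiedRicci (fun i => D i.succ) γ f i j) :=
      congrFun (congrFun H.metric_time_deriv i) j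
    rw [h1, map_neg, two_mul, map_add, two_mul]
  have hH := H.inv_time_deriv
  set S := algModifiedRicci (fun i => D i.succ) γ f with hSdef
  have hS : ∀ i j, S i j = S j i := fun i j => congrFun (congrFun hS' j) i
  set C := Matrix.of fun j l =>
      D i.succ (G j l) + D j.succ (G i l) - D l.succ (G i j) with hC
  have h1 : (2 : 𝒜) • γ i = C * h := H.leviCivita_matrix i
  have h2 : C = (2 : 𝒜) • (γ i * G) := by
    rw [← Matrix.smul_mul, h1, Matrix.mul_assoc, H.inv_mul, Matrix.mul_one]
  set X := Matrix.of fun j l =>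
      D i.succ (S j l) + D j.succ (S i l) - D l.succ (S i j) with hX
  have h3 : C.map (D 0) = -((2 : 𝒜) • X) := by
    ext j l
    simp only [hC, hX, Matrix.map_apply, Matrix.of_apply, map_add, map_sub, Matrix.neg_apply,
      Matrix.smul_apply, smul_eq_mul, H.comm 0, hG]
    ring
  -- Differentiate 2 γ_i = C h in time. The derivative of h contributes 4 γ_i S h, which supplies
  -- the Christoffel terms turning the partial derivatives in `X` into covariant ones.
  have h4 : (2 : 𝒜) • (γ i).map (D 0) = (2 : 𝒜) • (-((X - (2 : 𝒜) • (γ i * S)) * h)) := by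
    have h5 : (2 : 𝒜) • (γ i).map (D 0) = (C * h).map (D 0) := by
      rw [← h1, two_smul, two_smul, derivation_map_add]
    have h6 : C * h.map (D 0) = (4 : 𝒜) • (γ i * S * h) := by
      rw [hH, h2, Matrix.smul_mul, Matrix.mul_smul, smul_smul, ← Matrix.mul_assoc,
        ← Matrix.mul_assoc, Matrix.mul_assoc (γ i), H.mul_inv, Matrix.mul_one]
      norm_num
    rw [h5, derivation_map_mul, h3, h6, smul_neg, Matrix.sub_mul, smul_sub, Matrix.smul_mul,
      smul_smul, Matrix.neg_mul, Matrix.smul_mul]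
    norm_num
    abel
  have h7 := congrFun (congrFun (two_smul_cancel h4) j) k
  rw [Matrix.map_apply, Matrix.neg_apply, Matrix.mul_apply] at h7
  rw [h7]
  congr 1
  refine Finset.sum_congr rfl fun l _ => ?_
  rw [hs l k, mul_comm]
  congr 1
  simp only [algCovDeriv_apply, hX, Matrix.sub_apply, Matrix.of_apply, Matrix.smul_apply,
    Matrix.mul_apply, smul_eq_mul]
  -- Of the six Christoffel terms in the bracket, four cancel in pairs by symmetry, leaving -2
  -- γ_{ij}^m S_{ml}.
  have e1 : ∑ m, γ i l m * S j m = ∑ m, γ l i m * S m j :=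
    Finset.sum_congr rfl fun m _ => by rw [H.space_conn_symm i l, hS j m]
  have e2 : ∑ m, γ j l m * S i m = ∑ m, γ l j m * S i m :=
    Finset.sum_congr rfl fun m _ => by rw [H.space_conn_symm j l]
  have e3 : ∑ m, γ j i m * S m l = ∑ m, γ i j m * S m l :=
    Finset.sum_congr rfl fun m _ => by rw [H.space_conn_symm j i]
  rw [e1, e2, e3]; ring

theorem covDeriv_space (i j l : Fin n) :
    algCovDeriv D Γ (algModifiedRicci D Γ f) i.succ j.succ l.succ
      = algCovDeriv (fun i => D i.succ) γ (algModifiedRicci (fun i => D i.succ) γ f) i j l := by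
  simp only [algCovDeriv_apply, Fin.sum_univ_succ, H.conn_time, H.conn_space,
    H.modifiedRicci_space, zero_mul, zero_add]

theorem covDeriv_symm (a b c : Fin (n + 1)) :
    algCovDeriv D Γ (algModifiedRicci D Γ f) a b c
      = algCovDeriv D Γ (algModifiedRicci D Γ f) a c b := by
  simp only [algCovDeriv_apply, H.modifiedRicci_symm _ c, H.modifiedRicci_symm b]
  ring

/-- The evolution of the degenerate metric. -/
theorem metric_evolution (a b : Fin (n + 1)) :
    D 0 (padMatrix h a b) = 2 * ∑ c, ∑ d, padMatrix h a c * padMatrix h b d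
      * algModifiedRicci D Γ f c d := by
  refine Fin.cases (by simp) (fun i => ?_) a
  refine Fin.cases (by simp) (fun j => ?_) b
  have hs : ∀ i j, h i j = h j i := fun i j => congrFun (congrFun H.inv_symm j) i
  have h1 : D 0 (h i j) = 2 * (h * algModifiedRicci (fun i => D i.succ) γ f * h) i j :=
    congrFun (congrFun H.inv_time_deriv i) j
  simp only [Fin.sum_univ_succ, padMatrix_succ, padMatrix_zero_right, H.modifiedRicci_space,
    mul_zero, zero_mul, zero_add, Finset.sum_const_zero]
  rw [h1]
  congr 1
  simp only [Matrix.mul_apply, Finset.sum_mul]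
  rw [Finset.sum_comm]
  exact Finset.sum_congr rfl fun k _ => Finset.sum_congr rfl fun l _ => by rw [hs l j]; ring

/-- The evolution of the spacetime connection. -/
theorem conn_evolution (a b c : Fin (n + 1)) :
    D 0 (Γ a b c) = -∑ l, padMatrix h c l *
      (algCovDeriv D Γ (algModifiedRicci D Γ f) a b l
        + algCovDeriv D Γ (algModifiedRicci D Γ f) b a l
        - algCovDeriv D Γ (algModifiedRicci D Γ f) l a b) := by
  have h0 : ∀ b c, D 0 (Γ 0 b c) = _ := fun b c =>
    algConnection_time_evolution H.comm H.conn_symm H.pad_symm H.parallel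
      H.modifiedRicci_symm H.modifiedRicci_time H.conn_time_row b c
  refine Fin.cases (h0 b c) (fun i => ?_) a
  refine Fin.cases ?_ (fun j => ?_) b
  · rw [H.conn_symm, h0]
    congr 1
    exact Finset.sum_congr rfl fun l _ => by rw [H.covDeriv_symm l i.succ 0]; ring
  · refine Fin.cases (by simp [H.conn_time]) (fun k => ?_) c
    simp only [Fin.sum_univ_succ, padMatrix_zero_right, padMatrix_succ, zero_mul, zero_add,
      H.conn_space, H.covDeriv_space]
    exact H.space_conn_evolution i j k

end IsFlowConnection

end SpacetimeAlgebra

/-! ### The algebra of smooth functions on a set, with directional derivations -/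

section SmoothFunctions

variable {V : Type*} [NormedAddCommGroup V] [NormedSpace ℝ V]

/-- The algebra of real functions on a set that extend to functions smooth on the set. -/
def smoothFunctions (Ω : Set V) : Subalgebra ℝ (Ω → ℝ) where
  carrier := {F | ∃ F' : V → ℝ, ContDiffOn ℝ ∞ F' Ω ∧ ∀ p : Ω, F' p = F p}
  mul_mem' := by
    rintro a b ⟨a', ha, ha'⟩ ⟨b', hb, hb'⟩
    exact ⟨fun p => a' p * b' p, ha.mul hb, fun p => by simp [ha', hb']⟩
  add_mem' := by
    rintro a b ⟨a', ha, ha'⟩ ⟨b', hb, hb'⟩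
    exact ⟨fun p => a' p + b' p, ha.add hb, fun p => by simp [ha', hb']⟩
  algebraMap_mem' r := ⟨fun _ => r, contDiffOn_const, fun _ => rfl⟩

variable {Ω : Set V}

/-- The restriction of a smooth function. -/
def smoothRestrict {F : V → ℝ} (hF : ContDiffOn ℝ ∞ F Ω) : smoothFunctions Ω :=
  ⟨fun p => F p, F, hF, fun _ => rfl⟩

/-- A smooth extension. -/
noncomputable def smoothExtend (x : smoothFunctions Ω) : V → ℝ := x.2.choose

theorem contDiffOn_smoothExtend (x : smoothFunctions Ω) : ContDiffOn ℝ ∞ (smoothExtend x) Ω :=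
  x.2.choose_spec.1

theorem smoothExtend_apply (x : smoothFunctions Ω) (p : Ω) : smoothExtend x p = x.1 p :=
  x.2.choose_spec.2 p

/-- Evaluation at a point. -/
def smoothEval (p : Ω) : smoothFunctions Ω →ₐ[ℝ] ℝ :=
  (Pi.evalAlgHom ℝ (fun _ : Ω => ℝ) p).comp (smoothFunctions Ω).val

theorem smoothEval_apply (p : Ω) (x : smoothFunctions Ω) : smoothEval p x = x.1 p := rfl

theorem smoothFunctions_ext {x y : smoothFunctions Ω} (h : ∀ p, smoothEval p x = smoothEval p y) :
    x = y := Subtype.ext (funext h)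

theorem isUnit_smoothFunctions {x : smoothFunctions Ω} (h : ∀ p, smoothEval p x ≠ 0) :
    IsUnit x := by
  have hne : ∀ p ∈ Ω, smoothExtend x p ≠ 0 := fun p hp => by
    rw [smoothExtend_apply x ⟨p, hp⟩]; exact h ⟨p, hp⟩
  refine IsUnit.of_mul_eq_one (smoothRestrict ((contDiffOn_smoothExtend x).inv hne)) ?_
  refine smoothFunctions_ext fun p => ?_
  rw [map_mul, map_one, smoothEval_apply, smoothEval_apply, ← smoothExtend_apply]
  exact mul_inv_cancel₀ (hne p p.2)

/-- The derivative within Ω depends only on values on Ω; this makes the derivation below independent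
of the arbitrary choice of extension. -/
theorem fderivWithin_eq_smoothExtend {x : smoothFunctions Ω} {F : V → ℝ}
    (hF : ∀ p : Ω, F p = x.1 p) (p : Ω) :
    fderivWithin ℝ F Ω p = fderivWithin ℝ (smoothExtend x) Ω p :=
  fderivWithin_congr (fun q hq => by rw [hF ⟨q, hq⟩, smoothExtend_apply x ⟨q, hq⟩])
    (by rw [hF p, smoothExtend_apply x p])

theorem hasFDerivWithinAt_smoothExtend (x : smoothFunctions Ω) (p : Ω) :
    HasFDerivWithinAt (smoothExtend x) (fderivWithin ℝ (smoothExtend x) Ω p) Ω p :=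
  ((contDiffOn_smoothExtend x).differentiableOn (by simp) p p.2).hasFDerivWithinAt

theorem contDiffOn_fderivWithin_smoothExtend (hΩ : UniqueDiffOn ℝ Ω) (x : smoothFunctions Ω) :
    ContDiffOn ℝ ∞ (fderivWithin ℝ (smoothExtend x) Ω) Ω :=
  (contDiffOn_smoothExtend x).fderivWithin hΩ (by simp)

/-- The directional derivative. -/
noncomputable def smoothDeriv (hΩ : UniqueDiffOn ℝ Ω) (v : V) :
    Derivation ℝ (smoothFunctions Ω) (smoothFunctions Ω) :=
  Derivation.mk'
    { toFun := fun x => smoothRestrict (F := fun p => fderivWithin ℝ (smoothExtend x) Ω p v)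
        ((contDiffOn_fderivWithin_smoothExtend hΩ x).clm_apply contDiffOn_const)
      map_add' := fun x y => by
        refine Subtype.ext (funext fun p => ?_)
        change fderivWithin ℝ (smoothExtend (x + y)) Ω p v
          = fderivWithin ℝ (smoothExtend x) Ω p v + fderivWithin ℝ (smoothExtend y) Ω p v
        rw [← fderivWithin_eq_smoothExtend (x := x + y) (F := smoothExtend x + smoothExtend y)
          (fun p => by simp [smoothExtend_apply]) p,
          ((hasFDerivWithinAt_smoothExtend x p).add
            (hasFDerivWithinAt_smoothExtend y p)).fderivWithin (hΩ p p.2)]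
        rfl
      map_smul' := fun r x => by
        refine Subtype.ext (funext fun p => ?_)
        change fderivWithin ℝ (smoothExtend (r • x)) Ω p v
          = r • fderivWithin ℝ (smoothExtend x) Ω p v
        rw [← fderivWithin_eq_smoothExtend (x := r • x) (F := r • smoothExtend x)
          (fun p => by simp [smoothExtend_apply]) p,
          ((hasFDerivWithinAt_smoothExtend x p).const_smul r).fderivWithin (hΩ p p.2)]
        rfl }
    fun x y => by
      refine Subtype.ext (funext fun p => ?_)
      change fderivWithin ℝ (smoothExtend (x * y)) Ω p v
        = x.1 p * fderivWithin ℝ (smoothExtend y) Ω p v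
          + y.1 p * fderivWithin ℝ (smoothExtend x) Ω p v
      rw [← fderivWithin_eq_smoothExtend (x := x * y) (F := smoothExtend x * smoothExtend y)
        (fun p => by simp [smoothExtend_apply]) p,
        ((hasFDerivWithinAt_smoothExtend x p).mul
          (hasFDerivWithinAt_smoothExtend y p)).fderivWithin (hΩ p p.2)]
      simp [smoothExtend_apply]

theorem smoothEval_smoothDeriv (hΩ : UniqueDiffOn ℝ Ω) (v : V) (x : smoothFunctions Ω) (p : Ω) :
    smoothEval p (smoothDeriv hΩ v x) = fderivWithin ℝ (smoothExtend x) Ω p v := rfl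

/-- Second derivatives within Ω are symmetric at limits of interior points. This admits the initial
time, where only one-sided time derivatives exist. -/
theorem smoothDeriv_comm (hΩ : UniqueDiffOn ℝ Ω) (hcl : Ω ⊆ closure (interior Ω)) (v w : V)
    (x : smoothFunctions Ω) :
    smoothDeriv hΩ v (smoothDeriv hΩ w x) = smoothDeriv hΩ w (smoothDeriv hΩ v x) := by
  have key : ∀ (v w : V) (p : Ω), smoothEval p (smoothDeriv hΩ v (smoothDeriv hΩ w x))
      = fderivWithin ℝ (fderivWithin ℝ (smoothExtend x) Ω) Ω p v w := fun v w p => by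
    rw [smoothEval_smoothDeriv, ← fderivWithin_eq_smoothExtend
      (F := fun q => fderivWithin ℝ (smoothExtend x) Ω q w) (fun _ => rfl)]
    have h1 := ((contDiffOn_fderivWithin_smoothExtend hΩ x).differentiableOn (by simp) p
      p.2).hasFDerivWithinAt
    rw [(h1.clm_apply (hasFDerivWithinAt_const w _ _)).fderivWithin (hΩ p p.2)]
    simp
  refine smoothFunctions_ext fun p => ?_
  rw [key, key]
  exact ((contDiffOn_smoothExtend x) p p.2).isSymmSndFDerivWithinAt
    (by
      rw [minSmoothness_of_isRCLikeNormedField]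
      exact WithTop.coe_le_coe.mpr (le_top : (2 : ℕ∞) ≤ ⊤)) hΩ (hcl p.2) p.2 v w

end SmoothFunctions

/-! ### Coordinate expressions and their algebraic counterparts -/

section Represents

variable {ι P Q 𝒜 : Type*} [CommRing 𝒜] [Algebra ℝ 𝒜] (pt : Q → P) (ev : Q → 𝒜 →ₐ[ℝ] ℝ)

/-- The function `F` takes the values of the element `x` of an algebra at the points `pt q`. -/
def Represents (F : P → ℝ) (x : 𝒜) : Prop := ∀ q, F (pt q) = ev q x

variable {pt ev} [Fintype ι] {D' : ι → (P → ℝ) → P → ℝ} {D : ι → Derivation ℝ 𝒜 𝒜}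

/-- Both sides are the same polynomial in the symbols and their derivatives, and evaluation is a
homomorphism. The general `pt` and `ev` serve both all of space-time and a single time slice, on
which only spatial derivatives act. -/
theorem Represents.ricci (hD : ∀ i F x, Represents pt ev F x → Represents pt ev (D' i F) (D i x))
    {Γ' : ι → ι → ι → P → ℝ} {Γ : ι → Matrix ι ι 𝒜}
    (hΓ : ∀ i j k, Represents pt ev (Γ' i j k) (Γ i j k)) (i j : ι) :
    Represents pt ev (coordRicci D' Γ' i j) (algRicci D Γ i j) := fun q => by
  have h1 : ∀ a i j k, D' a (Γ' i j k) (pt q) = ev q (D a (Γ i j k)) :=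
    fun a i j k => hD a _ _ (hΓ i j k) q
  have h2 : ∀ i j k, Γ' i j k (pt q) = ev q (Γ i j k) := fun i j k => hΓ i j k q
  simp only [coordRicci, coordCurvature, algRicci, algCurvature, Matrix.add_apply,
    Matrix.sub_apply, Matrix.map_apply, Matrix.mul_apply, map_sum, map_add, map_sub, map_mul,
    h1, h2, Finset.sum_sub_distrib]

theorem Represents.hessian (hD : ∀ i F x, Represents pt ev F x → Represents pt ev (D' i F) (D i x))
    {Γ' : ι → ι → ι → P → ℝ} {Γ : ι → Matrix ι ι 𝒜}
    (hΓ : ∀ i j k, Represents pt ev (Γ' i j k) (Γ i j k)) {f' : P → ℝ} {f : 𝒜}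
    (hf : Represents pt ev f' f) (i j : ι) :
    Represents pt ev (coordHessian D' Γ' f' i j) (algHessian D Γ f i j) := fun q => by
  have h1 : ∀ i, D' i f' (pt q) = ev q (D i f) := fun i => hD i _ _ hf q
  have h2 : D' i (D' j f') (pt q) = ev q (D i (D j f)) := hD i _ _ (hD j _ _ hf) q
  have h3 : ∀ k, Γ' i j k (pt q) = ev q (Γ i j k) := fun k => hΓ i j k q
  simp only [coordHessian, algHessian, map_sub, map_sum, map_mul, h1, h2, h3]

theorem Represents.covDeriv
    (hD : ∀ i F x, Represents pt ev F x → Represents pt ev (D' i F) (D i x))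
    {Γ' : ι → ι → ι → P → ℝ} {Γ : ι → Matrix ι ι 𝒜}
    (hΓ : ∀ i j k, Represents pt ev (Γ' i j k) (Γ i j k)) {S' : ι → ι → P → ℝ} {S : Matrix ι ι 𝒜}
    (hS : ∀ i j, Represents pt ev (S' i j) (S i j)) (i j l : ι) :
    Represents pt ev (coordCovDeriv D' Γ' S' i j l) (algCovDeriv D Γ S i j l) := fun q => by
  have h1 : D' i (S' j l) (pt q) = ev q (D i (S j l)) := hD i _ _ (hS j l) q
  have h2 : ∀ i j, S' i j (pt q) = ev q (S i j) := fun i j => hS i j q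
  have h3 : ∀ i j k, Γ' i j k (pt q) = ev q (Γ i j k) := fun i j k => hΓ i j k q
  simp only [coordCovDeriv, algCovDeriv_apply, map_sub, map_sum, map_mul, h1, h2, h3]

variable [DecidableEq ι] {G' : ι → ι → P → ℝ} {G h : Matrix ι ι 𝒜}

theorem Represents.inverse (hG : ∀ i j, Represents pt ev (G' i j) (G i j)) (hinv : h * G = 1)
    (i j : ι) : Represents pt ev (coordInverse G' i j) (h i j) := fun q => by
  have h1 : (Matrix.of fun a b => G' a b (pt q)) = (ev q).mapMatrix G := by
    ext a b
    simpa using hG a b q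
  have h2 : (ev q).mapMatrix h * (ev q).mapMatrix G = 1 := by
    rw [← map_mul, hinv, map_one]
  rw [coordInverse, h1, Matrix.inv_eq_left_inv h2]
  rfl

theorem Represents.leviCivita
    (hD : ∀ i F x, Represents pt ev F x → Represents pt ev (D' i F) (D i x))
    (hG : ∀ i j, Represents pt ev (G' i j) (G i j)) (hinv : h * G = 1) {i j k : ι} {x : 𝒜}
    (hx : 2 * x = ∑ l, h k l * (D i (G j l) + D j (G i l) - D l (G i j))) :
    Represents pt ev (coordLeviCivita D' G' i j k) x := fun q => by
  have h1 : ∀ a i j, D' a (G' i j) (pt q) = ev q (D a (G i j)) :=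
    fun a i j => hD a _ _ (hG i j) q
  have h2 : ∀ i j, coordInverse G' i j (pt q) = ev q (h i j) :=
    fun i j => Represents.inverse hG hinv i j q
  have h3 := congrArg (ev q) hx
  simp only [map_mul, map_ofNat, map_sum, map_add, map_sub] at h3
  simp only [coordLeviCivita, h1, h2, ← h3]
  ring

theorem Represents.raise (hG : ∀ i j, Represents pt ev (G' i j) (G i j)) (hinv : h * G = 1)
    {S' : ι → ι → P → ℝ} {S : Matrix ι ι 𝒜} (hS : ∀ i j, Represents pt ev (S' i j) (S i j))
    (i k : ι) : Represents pt ev (coordRaise G' S' i k) (∑ l, h k l * S i l) := fun q => by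
  have h1 : ∀ i j, S' i j (pt q) = ev q (S i j) := fun i j => hS i j q
  have h2 : ∀ i j, coordInverse G' i j (pt q) = ev q (h i j) :=
    fun i j => Represents.inverse hG hinv i j q
  simp only [coordRaise, map_sum, map_mul, h1, h2]

theorem Represents.grad (hD : ∀ i F x, Represents pt ev F x → Represents pt ev (D' i F) (D i x))
    (hG : ∀ i j, Represents pt ev (G' i j) (G i j)) (hinv : h * G = 1)
    {f' : P → ℝ} {f : 𝒜} (hf : Represents pt ev f' f) (k : ι) :
    Represents pt ev (coordGrad D' G' f' k) (∑ l, h k l * D l f) := fun q => by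
  have h1 : ∀ i, D' i f' (pt q) = ev q (D i f) := fun i => hD i _ _ hf q
  have h2 : ∀ i j, coordInverse G' i j (pt q) = ev q (h i j) :=
    fun i j => Represents.inverse hG hinv i j q
  simp only [coordGrad, map_sum, map_mul, h1, h2]

theorem Represents.gradNormSq
    (hD : ∀ i F x, Represents pt ev F x → Represents pt ev (D' i F) (D i x))
    (hG : ∀ i j, Represents pt ev (G' i j) (G i j)) (hinv : h * G = 1)
    {f' : P → ℝ} {f : 𝒜} (hf : Represents pt ev f' f) :
    Represents pt ev (coordGradNormSq D' G' f') (∑ i, ∑ j, h i j * D i f * D j f) := fun q => by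
  have h1 : ∀ i, D' i f' (pt q) = ev q (D i f) := fun i => hD i _ _ hf q
  have h2 : ∀ i j, coordInverse G' i j (pt q) = ev q (h i j) :=
    fun i j => Represents.inverse hG hinv i j q
  simp only [coordGradNormSq, map_sum, map_mul, h1, h2]

theorem Represents.scalar (hD : ∀ i F x, Represents pt ev F x → Represents pt ev (D' i F) (D i x))
    (hG : ∀ i j, Represents pt ev (G' i j) (G i j)) (hinv : h * G = 1) {γ : ι → Matrix ι ι 𝒜}
    (hγ : ∀ i j k, 2 * γ i j k = ∑ l, h k l * (D i (G j l) + D j (G i l) - D l (G i j))) :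
    Represents pt ev (coordScalar D' G') (∑ i, ∑ j, h i j * algRicci D γ i j) := fun q => by
  have h1 : ∀ i j, coordRicci D' (coordLeviCivita D' G') i j (pt q) = ev q (algRicci D γ i j) :=
    fun i j => Represents.ricci hD (fun i j k => Represents.leviCivita hD hG hinv (hγ i j k)) i j q
  have h2 : ∀ i j, coordInverse G' i j (pt q) = ev q (h i j) :=
    fun i j => Represents.inverse hG hinv i j q
  simp only [coordScalar, map_sum, map_mul, h1, h2]

end Represents

/-! ### The time interval and translation by τ -/

section TimeInterval

theorem convex_timeInterval (T : EReal) (τ : ℝ) : Convex ℝ (timeInterval T τ) := by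
  refine OrdConnected.convex ⟨fun x hx y hy z hz => ⟨hx.1.trans hz.1, lt_of_le_of_lt ?_ hy.2⟩⟩
  exact_mod_cast add_le_add_left hz.2 τ

theorem add_mem_timeInterval {T : EReal} {τ t : ℝ} (hτ : 0 ≤ τ) (ht : t ∈ timeInterval T τ) :
    t + τ ∈ timeInterval T 0 :=
  ⟨add_nonneg ht.1 hτ, by rw [add_zero]; exact ht.2⟩

theorem interior_timeInterval_nonempty {T : EReal} {τ : ℝ} (hτ : τ ∈ timeInterval T 0) :
    (interior (timeInterval T τ)).Nonempty := by
  obtain ⟨c, h1, h2⟩ := EReal.lt_iff_exists_real_btwn.mp hτ.2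
  rw [add_zero, EReal.coe_lt_coe_iff] at h1
  have hsub : Ioo 0 (c - τ) ⊆ timeInterval T τ := fun s hs =>
    ⟨hs.1.le, lt_trans (EReal.coe_lt_coe_iff.mpr (by linarith [hs.2])) h2⟩
  exact (nonempty_Ioo.mpr (sub_pos.mpr h1)).mono (interior_maximal hsub isOpen_Ioo)

theorem uniqueDiffOn_timeInterval {T : EReal} {τ : ℝ} (hτ : τ ∈ timeInterval T 0) :
    UniqueDiffOn ℝ (timeInterval T τ) :=
  uniqueDiffOn_convex (convex_timeInterval T τ) (interior_timeInterval_nonempty hτ)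

theorem timeInterval_prod_subset_closure {E : Type*} [TopologicalSpace E] {T : EReal} {τ : ℝ}
    (hτ : τ ∈ timeInterval T 0) {U : Set E} (hU : IsOpen U) :
    timeInterval T τ ×ˢ U ⊆ closure (interior (timeInterval T τ ×ˢ U)) := by
  rw [interior_prod_eq, closure_prod_eq, hU.interior_eq,
    (convex_timeInterval T τ).closure_interior_eq_closure_of_nonempty_interior
      (interior_timeInterval_nonempty hτ)]
  exact prod_mono subset_closure subset_closure

theorem HasDerivWithinAt.comp_add_timeInterval {T : EReal} {τ t : ℝ} (hτ : 0 ≤ τ) {F : ℝ → ℝ}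
    {d : ℝ} (h : HasDerivWithinAt F d (timeInterval T 0) (t + τ)) :
    HasDerivWithinAt (fun s => F (s + τ)) d (timeInterval T τ) t := by
  have h1 : HasDerivWithinAt (fun s : ℝ => s + τ) 1 (timeInterval T τ) t :=
    (hasDerivWithinAt_id t _).add_const τ
  have h2 := h.comp t h1 (fun s hs => add_mem_timeInterval hτ hs)
  rw [mul_one] at h2
  exact h2

end TimeInterval

/-! ### Coordinate derivatives as derivations of the algebra -/

section SpacetimeDerivatives

variable {n : ℕ} {J : Set ℝ} {U : Set (EuclideanSpace ℝ (Fin n))}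

/-- The coordinate vectors of space-time. -/
noncomputable def spacetimeBasis (a : Fin (n + 1)) : ℝ × EuclideanSpace ℝ (Fin n) :=
  Fin.cases (1, 0) (fun i => (0, EuclideanSpace.single i 1)) a

/-- Evaluation at a point of a fixed time slice. -/
noncomputable def sliceEval {t : ℝ} (ht : t ∈ J) (u : U) : smoothFunctions (J ×ˢ U) →ₐ[ℝ] ℝ :=
  smoothEval ⟨(t, u.1), ht, u.2⟩

theorem represents_smoothRestrict {V : Type*} [NormedAddCommGroup V] [NormedSpace ℝ V] {Ω : Set V}
    {F : V → ℝ} (hF : ContDiffOn ℝ ∞ F Ω) :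
    Represents ((↑) : Ω → V) smoothEval F (smoothRestrict hF) := fun _ => rfl

/-- On a time slice F is known only on U; openness of U makes its full derivative there equal to the
derivative within U. -/
theorem represents_spaceDeriv (hU : IsOpen U) (hΩ : UniqueDiffOn ℝ (J ×ˢ U)) {t : ℝ} (ht : t ∈ J)
    (i : Fin n) (F : EuclideanSpace ℝ (Fin n) → ℝ) (x : smoothFunctions (J ×ˢ U))
    (hF : Represents ((↑) : U → _) (sliceEval ht) F x) :
    Represents ((↑) : U → _) (sliceEval ht) (spaceDeriv i F)
      (smoothDeriv hΩ (spacetimeBasis i.succ) x) := fun u => by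
  have h1 : HasFDerivWithinAt (fun v : EuclideanSpace ℝ (Fin n) => (t, v))
      (ContinuousLinearMap.inr ℝ ℝ (EuclideanSpace ℝ (Fin n))) U u :=
    (hasFDerivAt_prodMk_right t u.1).hasFDerivWithinAt
  have h2 := (hasFDerivWithinAt_smoothExtend x ⟨(t, u.1), ht, u.2⟩).comp u.1 h1
    (fun v hv => ⟨ht, hv⟩)
  have h3 : HasFDerivWithinAt F _ U u.1 := h2.congr
    (fun v hv => by
      rw [hF ⟨v, hv⟩]; exact (smoothExtend_apply x ⟨(t, v), ht, hv⟩).symm)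
    (by rw [hF u]; exact (smoothExtend_apply x ⟨(t, u.1), ht, u.2⟩).symm)
  have h4 := h3.hasFDerivAt (hU.mem_nhds u.2)
  rw [spaceDeriv, h4.fderiv, sliceEval, smoothEval_smoothDeriv]
  rfl

theorem hasDerivWithinAt_time (hΩ : UniqueDiffOn ℝ (J ×ˢ U)) {F : ℝ × EuclideanSpace ℝ (Fin n) → ℝ}
    {x : smoothFunctions (J ×ˢ U)} (hF : Represents ((↑) : J ×ˢ U → _) smoothEval F x)
    (p : J ×ˢ U) :
    HasDerivWithinAt (fun s => F (s, p.1.2)) (smoothEval p (smoothDeriv hΩ (spacetimeBasis 0) x))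
      J p.1.1 := by
  have h1 : HasDerivWithinAt (fun s : ℝ => (s, p.1.2)) (spacetimeBasis 0) J p.1.1 :=
    (hasDerivWithinAt_id p.1.1 J).prodMk (hasDerivWithinAt_const _ _ _)
  have h2 := (hasFDerivWithinAt_smoothExtend x p).comp_hasDerivWithinAt p.1.1 h1
    (fun s hs => (⟨hs, p.2.2⟩ : (s, p.1.2) ∈ J ×ˢ U))
  exact h2.congr
    (fun s hs => by
      rw [hF ⟨(s, p.1.2), hs, p.2.2⟩]; exact (smoothExtend_apply x ⟨(s, p.1.2), hs, p.2.2⟩).symm)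
    (by rw [hF p]; exact (smoothExtend_apply x p).symm)

theorem represents_spacetimeDeriv (hU : IsOpen U) (hJ : UniqueDiffOn ℝ J)
    (hΩ : UniqueDiffOn ℝ (J ×ˢ U)) (a : Fin (n + 1)) (F : ℝ × EuclideanSpace ℝ (Fin n) → ℝ)
    (x : smoothFunctions (J ×ˢ U)) (hF : Represents ((↑) : J ×ˢ U → _) smoothEval F x) :
    Represents ((↑) : J ×ˢ U → _) smoothEval (spacetimeDeriv J a F)
      (smoothDeriv hΩ (spacetimeBasis a) x) := fun p => by
  refine Fin.cases ?_ (fun i => ?_) a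
  · exact (hasDerivWithinAt_time hΩ hF p).derivWithin (hJ p.1.1 p.2.1)
  · exact represents_spaceDeriv hU hΩ p.2.1 i (fun v => F (p.1.1, v)) x
      (fun u => hF ⟨(p.1.1, u.1), p.2.1, u.2⟩) ⟨p.1.2, p.2.2⟩

end SpacetimeDerivatives

/-! ### Metric and function components in a chart -/

section Charts

theorem det_gram_ne_zero {n : ℕ} {W : Type*} [AddCommGroup W] [Module ℝ W] [TopologicalSpace W]
    {L : EuclideanSpace ℝ (Fin n) →L[ℝ] W} (hL : Function.Injective L) {B : W →L[ℝ] W →L[ℝ] ℝ}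
    (hB : ∀ w, w ≠ 0 → 0 < B w w) :
    (Matrix.of fun i j => B (L (EuclideanSpace.single i 1)) (L (EuclideanSpace.single j 1))).det
      ≠ 0 := by
  intro h0
  obtain ⟨c, hc, hc0⟩ := Matrix.exists_mulVec_eq_zero_iff.mpr h0
  -- A null vector c of the Gram matrix yields a nonzero w with B (L w) (L w) = 0, against
  -- positivity.
  set w : EuclideanSpace ℝ (Fin n) := ∑ j, c j • EuclideanSpace.single j (1 : ℝ) with hw
  have hw0 : w ≠ 0 := by
    intro h
    apply hc
    ext j
    have h1 := congrArg (fun v : EuclideanSpace ℝ (Fin n) => v j) h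
    simpa [hw, Finset.sum_apply, Pi.single_apply] using h1
  refine (hB (L w) fun h => hw0 (hL (h.trans (map_zero L).symm))).ne' ?_
  have h1 : ∀ i, B (L (EuclideanSpace.single i 1)) (L w) = 0 := fun i => by
    rw [← show _ = (0 : ℝ) from congrFun hc0 i]
    simp [hw, Matrix.mulVec, dotProduct, mul_comm]
  have h2 : B (L w) = ∑ i, c i • B (L (EuclideanSpace.single i 1)) := by simp [hw]
  rw [h2]
  simp [h1]

variable {n : ℕ} {M : Type*} [TopologicalSpace M] [ChartedSpace (EuclideanSpace ℝ (Fin n)) M]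
  {φ : OpenPartialHomeomorph M (EuclideanSpace ℝ (Fin n))}

theorem mdifferentiable_of_mem_smoothCharts (hφ : φ ∈ smoothCharts n M) :
    φ.MDifferentiable 𝓘(ℝ, EuclideanSpace ℝ (Fin n)) 𝓘(ℝ, EuclideanSpace ℝ (Fin n)) :=
  ⟨(contMDiffOn_of_mem_maximalAtlas hφ).mdifferentiableOn (by simp),
    (contMDiffOn_symm_of_mem_maximalAtlas hφ).mdifferentiableOn (by simp)⟩

theorem contDiffOn_funCoord {I : Set ℝ} {f : ℝ → M → ℝ}
    (hf : ContMDiffOn (𝓘(ℝ, ℝ).prod 𝓘(ℝ, EuclideanSpace ℝ (Fin n))) 𝓘(ℝ, ℝ) ∞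
      (fun p : ℝ × M => f p.1 p.2) (I ×ˢ univ)) (hφ : φ ∈ smoothCharts n M) :
    ContDiffOn ℝ ∞ (fun p : ℝ × EuclideanSpace ℝ (Fin n) => funCoord f φ p.1 p.2)
      (I ×ˢ φ.target) := by
  rw [← contMDiffOn_iff_contDiffOn, modelWithCornersSelf_prod, ← chartedSpaceSelf_prod]
  have h1 : ContMDiffOn (𝓘(ℝ, ℝ).prod 𝓘(ℝ, EuclideanSpace ℝ (Fin n)))
      (𝓘(ℝ, ℝ).prod 𝓘(ℝ, EuclideanSpace ℝ (Fin n))) ∞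
      (fun p : ℝ × EuclideanSpace ℝ (Fin n) => (p.1, φ.symm p.2)) (I ×ˢ φ.target) :=
    contMDiffOn_fst.prodMk ((contMDiffOn_symm_of_mem_maximalAtlas hφ).comp contMDiffOn_snd
      (fun p hp => hp.2))
  exact hf.comp h1 (fun p hp => ⟨hp.1, mem_univ _⟩)

variable [IsManifold 𝓘(ℝ, EuclideanSpace ℝ (Fin n)) ∞ M]

theorem metricCoord_symm (g : MetricFamily n M)
    (φ : OpenPartialHomeomorph M (EuclideanSpace ℝ (Fin n))) (t : ℝ) (i j : Fin n)
    (u : EuclideanSpace ℝ (Fin n)) : metricCoord g φ t i j u = metricCoord g φ t j i u :=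
  (g t).symm _ _ _

theorem det_metricCoord_ne_zero (g : MetricFamily n M) (hφ : φ ∈ smoothCharts n M) (t : ℝ)
    {u : EuclideanSpace ℝ (Fin n)} (hu : u ∈ φ.target) :
    (Matrix.of fun i j => metricCoord g φ t i j u).det ≠ 0 :=
  det_gram_ne_zero (L := mfderiv 𝓘(ℝ, EuclideanSpace ℝ (Fin n)) 𝓘(ℝ, EuclideanSpace ℝ (Fin n))
    φ.symm u) ((mdifferentiable_of_mem_smoothCharts hφ).symm.mfderiv_injective hu)
    ((g t).pos (φ.symm u))

theorem contDiffOn_comp_time_add {T : EReal} {τ : ℝ} (hτ : 0 ≤ τ)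
    {U : Set (EuclideanSpace ℝ (Fin n))} {F : ℝ → EuclideanSpace ℝ (Fin n) → ℝ}
    (hF : ContDiffOn ℝ ∞ (fun p : ℝ × EuclideanSpace ℝ (Fin n) => F p.1 p.2)
      (timeInterval T 0 ×ˢ U)) :
    ContDiffOn ℝ ∞ (fun p : ℝ × EuclideanSpace ℝ (Fin n) => F (p.1 + τ) p.2)
      (timeInterval T τ ×ˢ U) :=
  hF.comp (f := fun p : ℝ × EuclideanSpace ℝ (Fin n) => (p.1 + τ, p.2))
    (by fun_prop) (fun _ hp => ⟨add_mem_timeInterval hτ hp.1, hp.2⟩)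

end Charts

/-! ### Construction of the space-time connection over the algebra -/

section FlowConnection

variable {n : ℕ} {𝒜 : Type*} [CommRing 𝒜] [Algebra ℝ 𝒜]

theorem two_mul_half_mul (x : 𝒜) : 2 * (algebraMap ℝ 𝒜 (1 / 2) * x) = x := by
  rw [← mul_assoc, ← map_ofNat (algebraMap ℝ 𝒜) 2, ← map_mul]
  norm_num

variable (D : Fin (n + 1) → Derivation ℝ 𝒜 𝒜) (G h : Matrix (Fin n) (Fin n) 𝒜) (f : 𝒜)

/-- The Levi-Civita connection of the metric `G` with inverse `h`. -/
noncomputable def algLeviCivita (i : Fin n) : Matrix (Fin n) (Fin n) 𝒜 := fun j k =>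
  algebraMap ℝ 𝒜 (1 / 2) * ∑ l, h k l * (D i.succ (G j l) + D j.succ (G i l) - D l.succ (G i j))

/-- The function `-½ R + ∂f/∂t - ½ |∇f|²`. -/
noncomputable def algPotential : 𝒜 :=
  algebraMap ℝ 𝒜 (1 / 2) * (-∑ i, ∑ j, h i j * algRicci (fun i => D i.succ)
    (algLeviCivita D G h) i j + 2 * D 0 f - ∑ i, ∑ j, h i j * D i.succ f * D j.succ f)

/-- The mixed symbols `-R_i^k + ∇_i ∇^k f`. -/
noncomputable def algMixed (i k : Fin n) : 𝒜 :=
  -∑ l, h k l * algRicci (fun i => D i.succ) (algLeviCivita D G h) i l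
    + ∑ l, h k l * algHessian (fun i => D i.succ) (algLeviCivita D G h) f i l

/-- The spacetime connection. -/
noncomputable def algSpacetimeConn (a : Fin (n + 1)) : Matrix (Fin (n + 1)) (Fin (n + 1)) 𝒜 :=
  fun b c => Fin.cases 0
    (fun k => Fin.cases
      (Fin.cases (∑ l, h k l * D l.succ (algPotential D G h f)) (fun j => algMixed D G h f j k) b)
      (fun i => Fin.cases (algMixed D G h f i k) (fun j => algLeviCivita D G h i j k) b) a) c

variable {D G h f}

theorem isFlowConnection_algSpacetimeConn (hD : ∀ a b x, D a (D b x) = D b (D a x))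
    (hG : G.transpose = G) (hinv : h * G = 1)
    (hflow : ∀ i j, D 0 (G i j)
      = -2 * algRicci (fun i => D i.succ) (algLeviCivita D G h) i j
        + 2 * algHessian (fun i => D i.succ) (algLeviCivita D G h) f i j) :
    IsFlowConnection D G h (algLeviCivita D G h) (algSpacetimeConn D G h f) f
      (algPotential D G h f) where
  comm := hD
  metric_symm := hG
  inv_mul := hinv
  leviCivita _ _ _ := two_mul_half_mul _
  flow := hflow
  conn_time _ _ := rfl
  conn_space _ _ _ := rfl
  conn_mixed_left _ _ := rfl
  conn_mixed_right _ _ := rfl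
  conn_zero _ := rfl
  potential := two_mul_half_mul _

end FlowConnection

/-! ### From algebraic identities to derivatives at points -/

section Transfer

variable {n : ℕ} {J : Set ℝ} {U : Set (EuclideanSpace ℝ (Fin n))}

/-- Functions on space-time that represent a flow connection over the algebra of smooth functions
solve the modified Ricci flow for degenerate metrics. -/
theorem isDegenerateModifiedRicciFlow_of_represents (hU : IsOpen U) (hJ : UniqueDiffOn ℝ J)
    (hΩ : UniqueDiffOn ℝ (J ×ˢ U)) {G h : Matrix (Fin n) (Fin n) (smoothFunctions (J ×ˢ U))}
    {γ : Fin n → Matrix (Fin n) (Fin n) (smoothFunctions (J ×ˢ U))}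
    {Γ : Fin (n + 1) → Matrix (Fin (n + 1)) (Fin (n + 1)) (smoothFunctions (J ×ˢ U))}
    {f P : smoothFunctions (J ×ˢ U)}
    (H : IsFlowConnection (fun a => smoothDeriv hΩ (spacetimeBasis a)) G h γ Γ f P)
    {h' : Fin (n + 1) → Fin (n + 1) → ℝ × EuclideanSpace ℝ (Fin n) → ℝ}
    {Γ' : Fin (n + 1) → Fin (n + 1) → Fin (n + 1) → ℝ × EuclideanSpace ℝ (Fin n) → ℝ}
    {f' : ℝ × EuclideanSpace ℝ (Fin n) → ℝ}
    (hh : ∀ a b, Represents ((↑) : J ×ˢ U → _) smoothEval (h' a b) (padMatrix h a b))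
    (hΓ : ∀ a b c, Represents ((↑) : J ×ˢ U → _) smoothEval (Γ' a b c) (Γ a b c))
    (hf : Represents ((↑) : J ×ˢ U → _) smoothEval f' f) :
    IsDegenerateModifiedRicciFlow J U h' Γ' f' := by
  have hD := represents_spacetimeDeriv hU hJ hΩ
  have hS : ∀ a b, Represents ((↑) : J ×ˢ U → _) smoothEval (modifiedRicci J Γ' f' a b)
      (algModifiedRicci (fun a => smoothDeriv hΩ (spacetimeBasis a)) Γ f a b) := fun a b p => by
    rw [modifiedRicci, Represents.ricci hD hΓ a b p, Represents.hessian hD hΓ hf a b p, ← map_sub]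
    rfl
  have hC := Represents.covDeriv hD hΓ hS
  intro t ht u hu
  set p : J ×ˢ U := ⟨(t, u), ht, hu⟩ with hp
  have e1 : ∀ a b, h' a b (t, u) = smoothEval p (padMatrix h a b) := fun a b => hh a b p
  have e2 : ∀ a b, modifiedRicci J Γ' f' a b (t, u) = smoothEval p _ := fun a b => hS a b p
  have e3 : ∀ a b c, coordCovDeriv (spacetimeDeriv J) Γ' (modifiedRicci J Γ' f') a b c (t, u)
      = smoothEval p _ := fun a b c => hC a b c p
  refine ⟨fun i j => ?_, fun i j k => ?_⟩
  · have h1 := hasDerivWithinAt_time hΩ (hh i j) p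
    rw [H.metric_evolution] at h1
    simp only [e1, e2]
    simpa only [map_mul, map_sum, map_ofNat] using h1
  · have h1 := hasDerivWithinAt_time hΩ (hΓ i j k) p
    rw [H.conn_evolution] at h1
    simp only [e1, e3]
    simpa only [map_mul, map_sum, map_neg, map_add, map_sub] using h1

end Transfer

/-! ### The flow in a chart as an algebraic flow connection -/

theorem theorem3p7 {n : ℕ} {M : Type*} [TopologicalSpace M]
    [ChartedSpace (EuclideanSpace ℝ (Fin n)) M]
    [IsManifold 𝓘(ℝ, EuclideanSpace ℝ (Fin n)) ∞ M]
    (T : EReal) (g : MetricFamily n M) (f : ℝ → M → ℝ)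
    (hg : IsSmoothFamily (timeInterval T 0) g)
    (hf : ContMDiffOn (𝓘(ℝ, ℝ).prod 𝓘(ℝ, EuclideanSpace ℝ (Fin n))) 𝓘(ℝ, ℝ) ∞
      (fun p : ℝ × M => f p.1 p.2) (timeInterval T 0 ×ˢ univ))
    (hflow : IsModifiedRicciFlow (timeInterval T 0) g f)
    (τ : ℝ) (hτ : τ ∈ timeInterval T 0)
    (φ : OpenPartialHomeomorph M (EuclideanSpace ℝ (Fin n))) (hφ : φ ∈ smoothCharts n M) :
    IsDegenerateModifiedRicciFlow (timeInterval T τ) φ.target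
      (degMetric g τ φ) (degConnection (timeInterval T 0) g f τ φ)
      (fun p => funCoord f φ (p.1 + τ) p.2) := by
  have hU : IsOpen φ.target := φ.open_target
  have hJ : UniqueDiffOn ℝ (timeInterval T τ) := uniqueDiffOn_timeInterval hτ
  have hΩ : UniqueDiffOn ℝ (timeInterval T τ ×ˢ φ.target) := hJ.prod hU.uniqueDiffOn
  have hfI := contDiffOn_funCoord hf hφ
  have hGs := fun i j => contDiffOn_comp_time_add
    (F := fun t => metricCoord g φ t i j) hτ.1 (hg φ hφ i j)
  have hfs := contDiffOn_comp_time_add hτ.1 hfI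
  set D := fun a : Fin (n + 1) => smoothDeriv hΩ (spacetimeBasis a)
  set G : Matrix (Fin n) (Fin n) (smoothFunctions (timeInterval T τ ×ˢ φ.target)) :=
    Matrix.of fun i j => smoothRestrict (hGs i j)
  set F := smoothRestrict hfs
  -- Pointwise nondegeneracy makes the determinant a unit of the algebra, so the inverse metric has
  -- entries in the algebra.
  have hdet : IsUnit G.det := isUnit_smoothFunctions fun p => by
    rw [AlgHom.map_det]
    exact det_metricCoord_ne_zero g hφ _ p.2.2
  have hinv : G⁻¹ * G = 1 := Matrix.nonsing_inv_mul G hdet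
  have hslice : ∀ {t : ℝ} (ht : t ∈ timeInterval T τ) (i : Fin n) F x,
      Represents ((↑) : φ.target → _) (sliceEval ht) F x →
      Represents ((↑) : φ.target → _) (sliceEval ht) (spaceDeriv i F) (D i.succ x) :=
    fun ht => represents_spaceDeriv hU hΩ ht
  have rG : ∀ {t : ℝ} (ht : t ∈ timeInterval T τ) i j,
      Represents ((↑) : φ.target → _) (sliceEval ht) (metricCoord g φ (t + τ) i j) (G i j) :=
    fun _ _ _ _ => rfl
  have rF : ∀ {t : ℝ} (ht : t ∈ timeInterval T τ),
      Represents ((↑) : φ.target → _) (sliceEval ht) (funCoord f φ (t + τ)) F :=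
    fun _ _ => rfl
  have rγ : ∀ {t : ℝ} (ht : t ∈ timeInterval T τ) i j k,
      Represents ((↑) : φ.target → _) (sliceEval ht)
        (coordLeviCivita spaceDeriv (metricCoord g φ (t + τ)) i j k)
        (algLeviCivita D G G⁻¹ i j k) :=
    fun ht _ _ _ => Represents.leviCivita (hslice ht) (rG ht) hinv (two_mul_half_mul _)
  have rRic := fun {t : ℝ} (ht : t ∈ timeInterval T τ) => Represents.ricci (hslice ht) (rγ ht)
  have rHess := fun {t : ℝ} (ht : t ∈ timeInterval T τ) =>
    Represents.hessian (hslice ht) (rγ ht) (rF ht)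
  have rMixed : ∀ {t : ℝ} (ht : t ∈ timeInterval T τ) i k,
      Represents ((↑) : φ.target → _) (sliceEval ht) (mixedSymbol g f φ (t + τ) i k)
        (algMixed D G G⁻¹ F i k) := fun ht i k q => by
    rw [mixedSymbol, Represents.raise (rG ht) hinv (rRic ht) i k q,
      Represents.raise (rG ht) hinv (rHess ht) i k q, ← map_neg, ← map_add]
    rfl
  have rF' : Represents ((↑) : ↥(timeInterval T τ ×ˢ φ.target) → ℝ × EuclideanSpace ℝ (Fin n))
      smoothEval
      (fun p => funCoord f φ (p.1 + τ) p.2) F := represents_smoothRestrict hfs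
  have rP : ∀ {t : ℝ} (ht : t ∈ timeInterval T τ),
      Represents ((↑) : φ.target → _) (sliceEval ht)
        (timePotential (timeInterval T 0) g f φ (t + τ)) (algPotential D G G⁻¹ F) := by
    intro t ht q
    -- The potential differentiates f within [0, T) at t + τ, whereas `D 0` differentiates the
    -- translated function within [0, T - τ) at t; uniqueness of derivatives within the interval
    -- identifies the two, also at t = 0.
    have h1 : derivWithin (fun s => funCoord f φ s q.1) (timeInterval T 0) (t + τ)
        = sliceEval ht q (D 0 F) := by
      have hmem := add_mem_timeInterval hτ.1 ht
      have h2 : DifferentiableWithinAt ℝ (fun s => funCoord f φ s q.1) (timeInterval T 0)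
          (t + τ) := by
        have h3 : DifferentiableWithinAt ℝ
            (fun p : ℝ × EuclideanSpace ℝ (Fin n) => funCoord f φ p.1 p.2)
            (timeInterval T 0 ×ˢ φ.target) (t + τ, q.1) :=
          hfI.differentiableOn (by simp) _ ⟨hmem, q.2⟩
        exact h3.comp (f := fun s : ℝ => (s, q.1)) (t + τ) (by fun_prop)
          (fun s hs => ⟨hs, q.2⟩)
      exact (hJ t ht).eq_deriv _ (h2.hasDerivWithinAt.comp_add_timeInterval hτ.1)
        (hasDerivWithinAt_time hΩ rF' ⟨(t, q.1), ht, q.2⟩)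
    have h4 := congrArg (sliceEval ht q) (two_mul_half_mul
      (-∑ i, ∑ j, G⁻¹ i j * algRicci (fun i => D i.succ) (algLeviCivita D G G⁻¹) i j
        + 2 * D 0 F - ∑ i, ∑ j, G⁻¹ i j * D i.succ F * D j.succ F))
    have h5 := Represents.scalar (hslice ht) (rG ht) hinv (γ := algLeviCivita D G G⁻¹)
      (fun _ _ _ => two_mul_half_mul _) q
    have h6 := Represents.gradNormSq (hslice ht) (rG ht) hinv (rF ht) q
    change sliceEval ht q (2 * algPotential D G G⁻¹ F) = _ at h4
    rw [map_sub, map_add, map_neg, ← h5, ← h6, map_mul, map_mul, ← h1, map_ofNat] at h4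
    rw [timePotential]
    linear_combination -(1 / 2) * h4
  have H : IsFlowConnection D G G⁻¹ (algLeviCivita D G G⁻¹) (algSpacetimeConn D G G⁻¹ F) F
      (algPotential D G G⁻¹ F) := by
    refine isFlowConnection_algSpacetimeConn
      (fun a b x => smoothDeriv_comm hΩ (timeInterval_prod_subset_closure hτ hU) _ _ x)
      ?_ hinv fun i j => ?_
    · exact Matrix.ext fun i j => smoothFunctions_ext fun p =>
        metricCoord_symm g φ (p.1.1 + τ) j i p.1.2
    · refine smoothFunctions_ext fun p => ?_
      -- The flow equation, translated by τ, and the derivation `D 0` give two derivatives of the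
      -- same function within the same interval, which must agree.
      have h1 := (hflow φ hφ _ (add_mem_timeInterval hτ.1 p.2.1) p.1.2 p.2.2 i
        j).comp_add_timeInterval hτ.1
      have h2 := (hJ p.1.1 p.2.1).eq_deriv _ (hasDerivWithinAt_time hΩ
        (represents_smoothRestrict (hGs i j)) p) h1
      rw [rRic p.2.1 i j ⟨p.1.2, p.2.2⟩, rHess p.2.1 i j ⟨p.1.2, p.2.2⟩] at h2
      rw [map_add, map_mul, map_mul, map_neg, map_ofNat]
      exact h2
  refine isDegenerateModifiedRicciFlow_of_represents hU hJ hΩ H (fun a b p => ?_)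
    (fun a b c p => ?_) rF'
  · refine Fin.cases (map_zero (smoothEval p)).symm (fun i => ?_) a
    refine Fin.cases (map_zero (smoothEval p)).symm (fun j => ?_) b
    exact Represents.inverse (rG p.2.1) hinv i j ⟨p.1.2, p.2.2⟩
  · refine Fin.cases (map_zero (smoothEval p)).symm (fun k => ?_) c
    refine Fin.cases ?_ (fun i => ?_) a <;> refine Fin.cases ?_ (fun j => ?_) b
    · exact Represents.grad (hslice p.2.1) (rG p.2.1) hinv (rP p.2.1) k ⟨p.1.2, p.2.2⟩
    · exact rMixed p.2.1 j k ⟨p.1.2, p.2.2⟩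
    · exact rMixed p.2.1 i k ⟨p.1.2, p.2.2⟩
    · exact rγ p.2.1 i j k ⟨p.1.2, p.2.2⟩
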